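/- **Setting.** Let $M$ be a smooth Riemannian manifold without boundary, of dimension $c\ge 1$, with its Riemannian distance $d$ (the metric need only be continuous). For bijections $\phi_1,\dots,\phi_m$ of $M$ put $\Sigma=\{1,\dots,m\}^{\mathbb Z}$ and let $\Phi=\tau\ltimes(\phi_1,\dots,\phi_m)$ be the one-step skew-product on $\Sigma\times M$, $\Phi(\xi,x)=(\tau\xi,\phi_{\xi_0}(x))$, where $(\tau\xi)_i=\xi_{i+1}$. Write $\phi^n_\xi$ for the fiber map of $\Phi^n$ over $\xi$ ($n\in\mathbb Z$). Let $\nu\in(0,1)$ be the base of the metric of $\Sigma$ and $\alpha>0$ the Hölder exponent; $\Phi\in\mathcal{PHS}(M)$ means that there are $\nu^\alpha<\gamma<1<\hat\gamma^{-1}<\nu^{-\alpha}$ with $\gamma\, d(x,y)\le d(\phi_i(x),\phi_i(y))\le\hat\gamma^{-1}d(x,y)$ for all $i,x,y$. A nonempty compact $\Phi$-invariant set $\Gamma\subset\Sigma\times M$ is *hyperbolic* with $cs$-index $s$ and $cu$-index $t$ if the maps $\phi_\xi^n$ are $C^1$ near $x$ for all $(\xi,x)\in\Gamma$, $n\in\mathbb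 Z$, and there are a $D\phi_{\xi_0}$-invariant splitting $T_xM=E^s(\xi,x)\oplus E^u(\xi,x)$ over $\Gamma$ with $\dim E^s=s$, $\dim E^u=t$, and constants $C>0$, $0<\lambda<1$, with $\|D\phi^n_\xi(x)v\|\le C\lambda^n\|v\|$ for $v\in E^s(\xi,x)$ and $\|D\phi^{-n}_\xi(x)v\|\le C\lambda^n\|v\|$ for $v\in E^u(\xi,x)$, $n\ge0$. It is *transitive* if for all nonempty relatively open $U,V\subset\Gamma$ there is $n\ge0$ with $\Phi^n(U)\cap V\neq\emptyset$. Let $B,D\subset M$ be bounded open sets with $\overline B\subset D$ such that $\Gamma=\bigcap_{n\in\mathbb Z}\Phi^n(\Sigma\times\overline D)$ is a transitive hyperbolic set. Then $B$ is a *$cs$-blending region* with respect to $\{\phi_1,\dots,\phi_m\}$ on $D$ if $\{\phi_i(B)\}_i$ is an open cover of $\overline B$ and the $cs$-index of $\Gamma$ is positive, and a *$cu$-blending region* if $\{\phi_i^{-1}(B)\}_i$ is an open cover of $\overline B$ and the $cu$-index of $\Gamma$ is positive; the $cs$-index of the blending region is that of $\Gamma$. The semigroup $\langle\phi_1,\dots,\phi_m\rangle^+$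 of all finite nonempty compositions *has a transition from $A_1$ to $A_2$* if $T(x)\in A_2$ for some $x\in A_1$ and $T\in\langle\phi_1,\dots,\phi_m\rangle^+$. An *arc* of $C^r$-diffeomorphisms is a family $\phi(\varepsilon)$, $\varepsilon\ge0$, of $C^r$-diffeomorphisms of $M$ that is continuous in $\varepsilon$ in the $C^r$ topology (that is, all derivatives in $x$ up to order $r$ are jointly continuous in $(\varepsilon,x)$) and, locally in $\varepsilon$, varies only inside a compact subset of $M$. **Proposition.** For every $c\ge1$ there is an integer $k$, depending only on $c$, such that the following holds for every $M$ as above of dimension $c$, every $r\in\{0,1,2,\dots,\infty\}$, all $\nu\in(0,1)$ and $\alpha>0$, every integer $0\le j\le c$ (with $j=1$ if $c=1$), every $x\in M$ and every neighborhood $U$ of $x$. There are arcs $\phi_1(\varepsilon),\dots,\phi_{k+1}(\varepsilon)$, $\varepsilon\ge0$, of $C^r$-diffeomorphisms of $M$ with $\tau\ltimes(\phi_1(\varepsilon),\dots,\phi_{k+1}(\varepsilon))\in\mathcal{PHS}(M)$ for all $\varepsilon\ge0$ and $\phi_i(0)=\mathrm{id}$ for all $i$, and there are integers $s_1,s_2\ge0$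 with $s_1-s_2=j$, such that for every $\varepsilon>0$ there are disjoint bounded open sets $D_1,D_2\subset U\cap B_\varepsilon(x)$ and open sets $B_1,B_2$ for which - $B_1$ is a $cs$-blending region with respect to $\{\phi_1(\varepsilon),\dots,\phi_{k+1}(\varepsilon)\}$ on $D_1$, of $cs$-index $s_1$; - $B_2$ is a $cu$-blending region with respect to $\{\phi_1(\varepsilon),\dots,\phi_{k+1}(\varepsilon)\}$ on $D_2$, of $cs$-index $s_2$; - $\langle\phi_1(\varepsilon),\dots,\phi_{k+1}(\varepsilon)\rangle^+$ has a transition from $B_1$ to $B_2$ and from $B_2$ to $B_1$. -/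

import Mathlib

open Set Filter Topology
open scoped NNReal ENNReal Manifold ContDiff Bundle

universe u

noncomputable section

/-- The two-sided shift on bi-infinite sequences, `(τ ξ)_i = ξ_{i+1}`. -/
def shiftEquiv (ι : Type*) : Equiv.Perm (ℤ → ι) where
  toFun ξ := fun i => ξ (i + 1)
  invFun ξ := fun i => ξ (i - 1)
  left_inv ξ := by funext i; simp
  right_inv ξ := by funext i; simp

/-- The one-step skew-product `Φ = τ ⋉ (φ_i)_{i ∈ ι}`, `Φ (ξ, x) = (τ ξ, φ_{ξ_0} x)`, as a
bijection of `Σ × M`, where `Σ = ι^ℤ`. Its inverse is `(ξ, x) ↦ (τ⁻¹ ξ, φ_{ξ_{-1}}⁻¹ x)`. -/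
def oneStep {ι M : Type*} (φ : ι → Equiv.Perm M) : Equiv.Perm ((ℤ → ι) × M) where
  toFun z := (shiftEquiv ι z.1, φ (z.1 0) z.2)
  invFun z := ((shiftEquiv ι).symm z.1, (φ (z.1 (-1))).symm z.2)
  left_inv z := by
    obtain ⟨ξ, x⟩ := z
    simp [shiftEquiv]
  right_inv z := by
    obtain ⟨ξ, x⟩ := z
    simp [shiftEquiv]

/-- The fiber map of `Φ ^ n` over the sequence `ξ`, for `n ∈ ℤ`; for `n ≥ 1` it is
`φ_{ξ_{n-1}} ∘ ⋯ ∘ φ_{ξ_0}` and for `n = -m ≤ -1` it is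
`φ_{ξ_{-m}}⁻¹ ∘ ⋯ ∘ φ_{ξ_{-1}}⁻¹`. -/
def fiberMap {ι M : Type*} (φ : ι → Equiv.Perm M) (n : ℤ) (ξ : ℤ → ι) (x : M) : M :=
  ((oneStep φ ^ n) (ξ, x)).2

/-- The maximal invariant set `⋂_{n ∈ ℤ} Φ^n (Σ × closure D)`. -/
def maximalInvariantSet {ι M : Type*} [TopologicalSpace M] (φ : ι → Equiv.Perm M) (D : Set M) :
    Set ((ℤ → ι) × M) :=
  ⋂ n : ℤ, (fun z => (oneStep φ ^ n) z) '' (univ ×ˢ closure D)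

/-- The skew-product is partially hyperbolic with respect to the parameters `ν ∈ (0,1)` (the base
of the metric `ν ^ min {|i| : ξ_i ≠ ζ_i}` of `Σ`) and `α > 0` (the Hölder exponent): there are
`ν^α < γ < 1 < γ'⁻¹ < ν^{-α}` with
`γ d(x,y) ≤ d(φ_i x, φ_i y) ≤ γ'⁻¹ d(x,y)`. For a one-step map the Hölder
dependence of the fiber maps on the sequence is automatic. -/
def IsPHS {ι M : Type*} [EMetricSpace M] (ν α : ℝ) (φ : ι → Equiv.Perm M) : Prop :=
  ∃ γ γ' : ℝ≥0, ν ^ α < (γ : ℝ) ∧ γ < 1 ∧ ν ^ α < (γ' : ℝ) ∧ γ' < 1 ∧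
    ∀ i, AntilipschitzWith γ⁻¹ (φ i) ∧ LipschitzWith γ'⁻¹ (φ i)

/-- Topological transitivity of the restriction of `Φ` to the set `Γ`: every nonempty relatively
open subset of `Γ` has a forward iterate that meets any other one. -/
def IsTransitiveSet {X : Type*} [TopologicalSpace X] (Φ : Equiv.Perm X) (Γ : Set X) : Prop :=
  ∀ U V : Set X, IsOpen U → IsOpen V → (Γ ∩ U).Nonempty → (Γ ∩ V).Nonempty →
    ∃ n : ℕ, ((fun z => (Φ ^ n) z) '' (Γ ∩ U) ∩ (Γ ∩ V)).Nonempty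

/-- `Γ` is a (nonempty, compact, invariant) hyperbolic set of the one-step skew-product with
`cs`-index `s` and `cu`-index `t`: the fiber maps are `C^1` at the points of `Γ`, and over `Γ` the
tangent spaces of the fibers have an invariant splitting `E^s ⊕ E^u`, `dim E^s = s`, `dim E^u = t`,
with `E^s` uniformly contracted by forward iterates and `E^u` by backward iterates.
(The continuity of the splitting follows from these conditions.) -/
def IsHyperbolicSet (c : ℕ) {ι M : Type*} [TopologicalSpace ι] [TopologicalSpace M]
    [ChartedSpace (EuclideanSpace ℝ (Fin c)) M] [IsManifold (𝓡 c) ∞ M]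
    [Bundle.RiemannianBundle (fun x : M => TangentSpace (𝓡 c) x)]
    (φ : ι → Equiv.Perm M) (Γ : Set ((ℤ → ι) × M)) (s t : ℕ) : Prop :=
  Γ.Nonempty ∧ IsCompact Γ ∧ oneStep φ '' Γ = Γ ∧
  (∀ (n : ℤ) (ξ : ℤ → ι) (x : M), (ξ, x) ∈ Γ →
    ContMDiffAt (𝓡 c) (𝓡 c) 1 (fiberMap φ n ξ) x) ∧
  ∃ (Es Eu : (ℤ → ι) → ∀ x : M, Submodule ℝ (TangentSpace (𝓡 c) x)) (C lam : ℝ),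
    0 < C ∧ 0 < lam ∧ lam < 1 ∧
    ∀ (ξ : ℤ → ι) (x : M), (ξ, x) ∈ Γ →
      IsCompl (Es ξ x) (Eu ξ x) ∧
      Module.finrank ℝ (Es ξ x) = s ∧ Module.finrank ℝ (Eu ξ x) = t ∧
      (Es ξ x).map (mfderiv (𝓡 c) (𝓡 c) (φ (ξ 0)) x).toLinearMap
        = Es (shiftEquiv ι ξ) (φ (ξ 0) x) ∧
      (Eu ξ x).map (mfderiv (𝓡 c) (𝓡 c) (φ (ξ 0)) x).toLinearMap
        = Eu (shiftEquiv ι ξ) (φ (ξ 0) x) ∧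
      (∀ n : ℕ, ∀ v ∈ Es ξ x,
        ‖mfderiv (𝓡 c) (𝓡 c) (fiberMap φ (n : ℤ) ξ) x v‖ ≤ C * lam ^ n * ‖v‖) ∧
      (∀ n : ℕ, ∀ v ∈ Eu ξ x,
        ‖mfderiv (𝓡 c) (𝓡 c) (fiberMap φ (-(n : ℤ)) ξ) x v‖ ≤ C * lam ^ n * ‖v‖)

/-- The conditions common to `cs`- and `cu`-blending regions: `B` and `D` are bounded open sets
with `closure B ⊆ D`, and the maximal invariant set `Γ` in `Σ × closure D` is a transitive
hyperbolic set with `cs`-index `s` and `cu`-index `t`. The alphabet is the index type `ι` of the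
family, so that `Σ = ι^ℤ` is the space of all sequences of symbols of the family. -/
def IsBlendingPair (c : ℕ) {ι M : Type*} [TopologicalSpace ι] [EMetricSpace M]
    [ChartedSpace (EuclideanSpace ℝ (Fin c)) M] [IsManifold (𝓡 c) ∞ M]
    [Bundle.RiemannianBundle (fun x : M => TangentSpace (𝓡 c) x)]
    (φ : ι → Equiv.Perm M) (B D : Set M) (s t : ℕ) : Prop :=
  IsOpen B ∧ IsOpen D ∧ Metric.ediam B ≠ ⊤ ∧ Metric.ediam D ≠ ⊤ ∧ closure B ⊆ D ∧
  IsHyperbolicSet c φ (maximalInvariantSet φ D) s t ∧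
  IsTransitiveSet (oneStep φ) (maximalInvariantSet φ D)

/-- `B` is a `cs`-blending region with respect to `{φ_i}` on `D`, with `cs`-index `s` and
`cu`-index `t`: `{φ_i(B)}` covers the closure of `B`, and the `cs`-index is positive. -/
def IsCsBlendingRegion (c : ℕ) {ι M : Type*} [TopologicalSpace ι] [EMetricSpace M]
    [ChartedSpace (EuclideanSpace ℝ (Fin c)) M] [IsManifold (𝓡 c) ∞ M]
    [Bundle.RiemannianBundle (fun x : M => TangentSpace (𝓡 c) x)]
    (φ : ι → Equiv.Perm M) (B D : Set M) (s t : ℕ) : Prop :=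
  IsBlendingPair c φ B D s t ∧
  (∀ i, IsOpen (φ i '' B)) ∧ closure B ⊆ ⋃ i, φ i '' B ∧ 0 < s

/-- `B` is a `cu`-blending region with respect to `{φ_i}` on `D`, with `cs`-index `s` and
`cu`-index `t`: `{φ_i⁻¹(B)}` covers the closure of `B`, and the `cu`-index is positive. -/
def IsCuBlendingRegion (c : ℕ) {ι M : Type*} [TopologicalSpace ι] [EMetricSpace M]
    [ChartedSpace (EuclideanSpace ℝ (Fin c)) M] [IsManifold (𝓡 c) ∞ M]
    [Bundle.RiemannianBundle (fun x : M => TangentSpace (𝓡 c) x)]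
    (φ : ι → Equiv.Perm M) (B D : Set M) (s t : ℕ) : Prop :=
  IsBlendingPair c φ B D s t ∧
  (∀ i, IsOpen ((φ i).symm '' B)) ∧ closure B ⊆ ⋃ i, (φ i).symm '' B ∧ 0 < t

/-- The semigroup `⟨φ_i : i ∈ ι⟩⁺` generated by the maps under composition. -/
def generatedSemigroup {ι M : Type*} (φ : ι → Equiv.Perm M) : Subsemigroup (Equiv.Perm M) :=
  Subsemigroup.closure (range φ)

/-- `⟨φ_i : i ∈ ι⟩⁺` has a transition from `A₁` to `A₂`. -/
def HasTransition {ι M : Type*} (φ : ι → Equiv.Perm M) (A₁ A₂ : Set M) : Prop :=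
  ∃ x ∈ A₁, ∃ T ∈ generatedSemigroup φ, T x ∈ A₂

/-- An arc `ε ↦ f ε`, `ε ≥ 0`, of `C^r` diffeomorphisms of `M`, that is, a curve that is
continuous in the `C^r` topology: `f ε x` and, in charts, all its partial derivatives in `x` up to
order `r` are jointly continuous in `(ε, x)`, and locally in `ε` the diffeomorphism varies only
inside a compact set. The last condition is void when `M` is compact; in general it gives
continuity in the strong (Whitney) topology, and not only in the weak one. -/
def IsArc (c : ℕ) {M : Type*} [TopologicalSpace M]
    [ChartedSpace (EuclideanSpace ℝ (Fin c)) M] (r : ℕ∞)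
    (f : ℝ≥0 → M ≃ₘ^(r : WithTop ℕ∞)⟮𝓡 c, 𝓡 c⟯ M) : Prop :=
  Continuous (fun p : ℝ≥0 × M => f p.1 p.2) ∧
  (∀ (ε₀ : ℝ≥0) (x₀ : M) (m : ℕ), (m : ℕ∞) ≤ r →
    ContinuousAt
      (fun p : ℝ≥0 × EuclideanSpace ℝ (Fin c) =>
        iteratedFDeriv ℝ m
          (fun w => extChartAt (𝓡 c) (f ε₀ x₀) (f p.1 ((extChartAt (𝓡 c) x₀).symm w))) p.2)
      (ε₀, extChartAt (𝓡 c) x₀ x₀)) ∧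
  ∀ ε₀ : ℝ≥0, ∃ K : Set M, IsCompact K ∧ ∀ᶠ ε in 𝓝 ε₀, ∀ x ∉ K, f ε x = f ε₀ x

end

/-! Everything happens in one chart near $x$, at a scale $t=\theta(\varepsilon)$ that tends to $0$
with $\varepsilon$. Put $\delta=\kappa e^{-1/t}$ and $z=(w-w_0)/t$, where $w_0$ is the image of $x$.
Each map is $w\mapsto w+\delta t\,(A(z)+\delta A'(z))$ with $A,A'$ smooth and compactly supported.
Since $e^{-1/t}V(w/t)$ is smooth in $(t,w)$ across $t=0$ (`contDiff_expNegInvGlue_smul_rescale`),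
these families are arcs starting at the identity. The displacement has a Lipschitz constant of order
$\kappa$, uniformly in $t$, and the Riemannian metric is nearly constant in a small chart ball.
Hence a small $\kappa$ makes the maps and their inverses as close to isometries as $\mathcal{PHS}$
demands (`exists_lipschitzWith_chartConj`).

There are $2^c+2$ maps. For $2^c$ of them, labelled by sign vectors $b\in\{\pm1\}^c$, the field $A$
has two linear saddles, at $0$ and at $e_1/4$, contracting exactly the coordinates in $S_1$ and
$S_2$ respectively, and $A'=\tfrac{6}{16}b$ near both. With $u=\delta t/16$ such a map is, near the
saddle at $p$, affine with rates $1\mp\delta$, and its fixed point is a vertex of the cube of half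
side $6u$ around $p$. The last two maps are the translations by $\pm\delta t e_1=\pm16u\,e_1$.

Take for $B$ and $D$ the cubes of half sides $5u$ and $7u$. Choosing each sign from the side of $p$
on which the coordinate lies shows that images and preimages of $B$ both cover $\overline B$,
whatever the numbers of contracting and expanding directions are (`exists_blenderMap_preimage`,
`exists_blenderMap_mem`). A translation moves points by $16u>14u$, so an orbit that stays in
$\overline D$ uses saddle symbols only. In each coordinate it then solves a scalar hyperbolic
recursion, which has exactly one bounded solution. So $\Gamma$ is a continuous graph over the full
shift on $2^c$ symbols: it is compact and transitive, and the coordinate splitting makes it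
hyperbolic (`maximalInvariantSet_eq`, `isHyperbolicSet_and_isTransitiveSet`). Iterating a
translation reaches the other saddle with an error of at most $8u$. Split between the start and the
end, that is $4u<5u$, which gives the transitions (`hasTransition`).

Only $\#S_1-\#S_2=j$ with $S_1$ and the complement of $S_2$ nonempty is left to arrange
(`exists_signatures`). -/

noncomputable section

/-! ### Smoothness of rescaled families with flat amplitude. -/

section FlatRescaling

open Polynomial

universe v
variable {E F : Type v} [NormedAddCommGroup E] [NormedSpace ℝ E]
  [NormedAddCommGroup F] [NormedSpace ℝ F]

/-- The rescaling `(t, w) ↦ V (w / t)` of `V`, multiplied by `p (1 / t)` and by the flat function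
`exp (-1 / t)`. -/
def flatRescale (p : ℝ[X]) (V : E → F) (q : ℝ × E) : F :=
  (p.eval q.1⁻¹ * expNegInvGlue q.1) • V (q.1⁻¹ • q.2)

/-- The candidate for the derivative of `flatRescale p V`. -/
def flatRescaleDeriv (p : ℝ[X]) (V : E → F) (q : ℝ × E) : (ℝ × E) →L[ℝ] F :=
  (ContinuousLinearMap.fst ℝ ℝ E).smulRight
      (flatRescale (X ^ 2 * (p - derivative (R := ℝ) p)) V q)
    + (flatRescale (p * X) (fderiv ℝ V) q).comp (ContinuousLinearMap.snd ℝ ℝ E)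
    - (ContinuousLinearMap.fst ℝ ℝ E).smulRight
      (flatRescale (p * X) (fun z => fderiv ℝ V z z) q)

/-- At $t=0$ boundedness of `V` reduces the claim to $p(1/t)e^{-1/t}=o(t)$; elsewhere it is the
chain rule. Carrying the polynomial `p` makes the class closed under differentiation: every term of
the derivative is again a `flatRescale`, of `V`, of $V'$ or of $z\mapsto V'(z)z$. -/
theorem hasFDerivAt_flatRescale (p : ℝ[X]) {V : E → F} (hV : ContDiff ℝ 1 V)
    (hc : HasCompactSupport V) (q : ℝ × E) :
    HasFDerivAt (flatRescale p V) (flatRescaleDeriv p V q) q := by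
  obtain ⟨t, w⟩ := q
  by_cases ht : t = 0
  · subst ht
    have h0 : flatRescaleDeriv p V (0, w) = 0 := by
      simp [flatRescaleDeriv, flatRescale]
    rw [h0]
    obtain ⟨C, hC⟩ := hc.exists_bound_of_continuous hV.continuous
    have hd := expNegInvGlue.hasDerivAt_polynomial_eval_inv_mul p 0
    simp only [expNegInvGlue.zero, mul_zero] at hd
    rw [hasDerivAt_iff_isLittleO] at hd
    simp only [expNegInvGlue.zero, mul_zero, sub_zero, smul_zero] at hd
    rw [hasFDerivAt_iff_isLittleO]
    have h1 : Tendsto (fun q : ℝ × E => q.1) (𝓝 (0, w)) (𝓝 0) :=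
      continuous_fst.tendsto' _ _ rfl
    have h2 := hd.comp_tendsto h1
    have h3 : (fun q : ℝ × E => flatRescale p V q - flatRescale p V (0, w)
        - (0 : (ℝ × E) →L[ℝ] F) (q - (0, w))) =O[𝓝 (0, w)]
        ((fun x : ℝ => p.eval x⁻¹ * expNegInvGlue x) ∘ fun q : ℝ × E => q.1) := by
      refine Asymptotics.IsBigO.of_bound C (Eventually.of_forall fun q => ?_)
      simp only [flatRescale, expNegInvGlue.zero, mul_zero, zero_smul, sub_zero,
        _root_.zero_apply, norm_smul, Function.comp]
      rw [mul_comm]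
      exact mul_le_mul_of_nonneg_right (hC _) (norm_nonneg _)
    refine h3.trans_isLittleO (h2.trans_isBigO ?_)
    refine Asymptotics.IsBigO.of_bound 1 (Eventually.of_forall fun q => ?_)
    simp only [Function.comp, one_mul]
    refine le_trans ?_ (norm_fst_le _)
    simp
  · have hd : HasFDerivAt (fun q : ℝ × E => p.eval q.1⁻¹ * expNegInvGlue q.1) _ (t, w) :=
      HasFDerivAt.comp (t, w) (f := fun q : ℝ × E => q.1)
        (expNegInvGlue.hasDerivAt_polynomial_eval_inv_mul p t).hasFDerivAt hasFDerivAt_fst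
    have hi : HasFDerivAt (fun q : ℝ × E => q.1⁻¹) _ (t, w) :=
      HasFDerivAt.comp (t, w) (f := fun q : ℝ × E => q.1) (hasDerivAt_inv ht).hasFDerivAt
        hasFDerivAt_fst
    have hz : HasFDerivAt (fun q : ℝ × E => q.1⁻¹ • q.2) _ (t, w) := hi.smul hasFDerivAt_snd
    have hVd : HasFDerivAt V (fderiv ℝ V (t⁻¹ • w)) (t⁻¹ • w) :=
      (hV.differentiable one_ne_zero _).hasFDerivAt
    have hV' : HasFDerivAt (fun q : ℝ × E => V (q.1⁻¹ • q.2)) _ (t, w) :=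
      HasFDerivAt.comp (t, w) (f := fun q : ℝ × E => q.1⁻¹ • q.2) hVd hz
    refine (hd.smul hV').congr_fderiv (ContinuousLinearMap.prod_ext ?_ ?_)
    · ext
      simp [flatRescaleDeriv, flatRescale, smul_smul]
      rw [← sub_eq_neg_add, sub_right_inj]
      congr 1
      field_simp
    · ext v
      simp [flatRescaleDeriv, flatRescale, smul_smul]
      congr 1
      ring

/-- Induction on the order. $V'$ and $z\mapsto V'(z)z$ are again smooth with compact support, so the
induction hypothesis covers the derivative. `F` is quantified inside because the target changes to
`E →L[ℝ] F`, which is also why `E` and `F` share a universe. -/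
theorem contDiff_flatRescale_nat (n : ℕ) : ∀ {F : Type v} [NormedAddCommGroup F]
    [NormedSpace ℝ F] (p : ℝ[X]) {V : E → F}, ContDiff ℝ ∞ V → HasCompactSupport V →
    ContDiff ℝ n (flatRescale p V) := by
  induction n with
  | zero =>
    intro F _ _ p V hV hc
    refine contDiff_zero.2 (continuous_iff_continuousAt.2 fun q => ?_)
    exact (hasFDerivAt_flatRescale p (hV.of_le (mod_cast le_top)) hc q).continuousAt
  | succ n ih =>
    intro F _ _ p V hV hc
    have hV' : ContDiff ℝ ∞ (fderiv ℝ V) := hV.fderiv_right (m := ∞) (by simp)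
    refine (contDiff_succ_iff_hasFDerivAt (n := n)).2 ⟨flatRescaleDeriv p V, ?_, fun q =>
      hasFDerivAt_flatRescale p (hV.of_le (mod_cast le_top)) hc q⟩
    have hc2 : HasCompactSupport fun z => fderiv ℝ V z z := by
      refine (hc.fderiv ℝ).mono fun z hz => ?_
      simp only [Function.mem_support] at hz ⊢
      intro h
      simp [h] at hz
    have a1 := ih (X ^ 2 * (p - derivative (R := ℝ) p)) hV hc
    have a2 := ih (p * X) hV' (hc.fderiv ℝ)
    have a3 := ih (p * X) (V := fun z => fderiv ℝ V z z) (hV'.clm_apply contDiff_id) hc2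
    exact ((contDiff_const.smulRight a1).add (a2.clm_comp contDiff_const)).sub
      (contDiff_const.smulRight a3)

/-- A rescaled compactly supported smooth map `V (w / t)`, multiplied by `exp (-1 / t)` and extended
by zero to `t ≤ 0`, is smooth in `(t, w)`. -/
theorem contDiff_expNegInvGlue_smul_rescale {V : E → F} (hV : ContDiff ℝ ∞ V)
    (hc : HasCompactSupport V) :
    ContDiff ℝ ∞ (fun q : ℝ × E => expNegInvGlue q.1 • V (q.1⁻¹ • q.2)) := by
  have h := contDiff_infty.2 fun n => contDiff_flatRescale_nat n 1 hV hc
  have h1 : flatRescale 1 V = fun q : ℝ × E => expNegInvGlue q.1 • V (q.1⁻¹ • q.2) := by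
    ext q
    simp [flatRescale]
  rwa [h1] at h

end FlatRescaling

/-! ### Inverting perturbations of the identity. -/

section PerturbationOfIdentity

variable {E : Type*} [NormedAddCommGroup E] [NormedSpace ℝ E] [CompleteSpace E]

/-- A perturbation of the identity with Lipschitz constant smaller than one is a diffeomorphism,
and its inverse is again a perturbation of the identity. -/
theorem exists_homeomorph_of_lipschitzWith_sub_id {f : E → E} (hf : ContDiff ℝ ∞ f) {η : ℝ≥0}
    (hη : η < 1) (hL : LipschitzWith η (fun w => f w - w)) :
    ∃ h : E ≃ₜ E, (∀ w, h w = f w) ∧ ContDiff ℝ ∞ h.symm ∧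
      LipschitzWith (η / (1 - η)) (fun w => h.symm w - w) := by
  rcases subsingleton_or_nontrivial E with hE | hE
  · refine ⟨Homeomorph.refl E, fun w => Subsingleton.elim _ _, contDiff_id, ?_⟩
    exact LipschitzWith.of_dist_le_mul fun x y => by simp [Subsingleton.elim x y]
  have hη' : (η : ℝ) < 1 := by exact_mod_cast hη
  have happ : ApproximatesLinearOn f ((ContinuousLinearEquiv.refl ℝ E : E ≃L[ℝ] E) : E →L[ℝ] E)
      univ η := by
    intro x _ y _
    have := hL.dist_le_mul x y
    rw [dist_eq_norm, dist_eq_norm] at this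
    have h1 : f x - f y - (x - y) = f x - x - (f y - y) := by abel
    change ‖f x - f y - (x - y)‖ ≤ _
    rwa [h1]
  have hN : Subsingleton E ∨
      η < ‖((ContinuousLinearEquiv.refl ℝ E).symm : E →L[ℝ] E)‖₊⁻¹ := by
    right
    have : ‖((ContinuousLinearEquiv.refl ℝ E).symm : E →L[ℝ] E)‖₊ = 1 := by
      ext
      exact ContinuousLinearMap.norm_id
    rw [this, inv_one]
    exact hη
  let h := ApproximatesLinearOn.toHomeomorph (f' := ContinuousLinearEquiv.refl ℝ E) f happ hN
  have hh : ∀ w, h w = f w := fun w => rfl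
  have hd : ∀ w, ‖1 - fderiv ℝ f w‖ < 1 := by
    intro w
    have h1 : HasFDerivAt (fun w => f w - w) (fderiv ℝ f w - 1) w :=
      (hf.differentiable (by simp) w).hasFDerivAt.sub (hasFDerivAt_id w)
    have h2 := h1.le_of_lipschitz hL
    rw [norm_sub_rev]
    exact h2.trans_lt hη'
  -- The derivative is $1-(1-f'(w))$, invertible by the Neumann series; smoothness of the inverse
  -- then follows from the inverse function theorem.
  let f' : E → E ≃L[ℝ] E := fun w =>
    ContinuousLinearEquiv.unitsEquiv ℝ E (Units.oneSub (1 - fderiv ℝ f w) (hd w))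
  have hf' : ∀ w, HasFDerivAt h (f' w : E →L[ℝ] E) w := by
    intro w
    have h1 : (f' w : E →L[ℝ] E) = fderiv ℝ f w := by
      ext v
      simp [f']
    rw [h1]
    exact (hf.differentiable (by simp) w).hasFDerivAt
  refine ⟨h, hh, h.contDiff_symm hf' hf, ?_⟩
  refine LipschitzWith.of_dist_le_mul fun x y => ?_
  obtain ⟨a, rfl⟩ := h.surjective x
  obtain ⟨b, rfl⟩ := h.surjective y
  have hs : ∀ a, h.symm (f a) = a := h.symm_apply_apply
  simp only [hh, hs]
  have h1 := hL.dist_le_mul a b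
  rw [dist_eq_norm, dist_eq_norm] at h1 ⊢
  -- The displacement of the inverse at $f(a)$ is minus that of $f$ at $a$. From
  -- $\|a-b\|\le\|f(a)-f(b)\|+\eta\|a-b\|$ its Lipschitz constant is $\eta/(1-\eta)$.
  have h2 : ‖a - b‖ ≤ ‖f a - f b‖ + ‖f a - a - (f b - b)‖ := by
    have : a - b = (f a - f b) - (f a - a - (f b - b)) := by abel
    rw [this]
    exact norm_sub_le _ _
  have h3 : ‖a - f a - (b - f b)‖ = ‖f a - a - (f b - b)‖ := by
    rw [← norm_neg]; congr 1; abel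
  rw [h3]
  have h4 : 0 < 1 - (η : ℝ) := by linarith
  rw [NNReal.coe_div, NNReal.coe_sub hη.le, NNReal.coe_one, div_mul_eq_mul_div, le_div_iff₀ h4]
  nlinarith [norm_nonneg (f a - a - (f b - b)), η.coe_nonneg]

end PerturbationOfIdentity

/-! ### Joint continuity of the derivatives in the space variable. -/

section PartialDerivatives

variable {E F : Type*} [NormedAddCommGroup E] [NormedSpace ℝ E]
  [NormedAddCommGroup F] [NormedSpace ℝ F]

/-- A slice is the linear inclusion $w\mapsto(0,w)$ followed by a translation, and iterated
derivatives commute with both. The derivative is taken within an open set because `G` is smooth only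
near `p`. -/
theorem iteratedFDeriv_partial_eq {G : ℝ × E → F} {m : ℕ} {p : ℝ × E} (hG : ContDiffAt ℝ m G p) :
    iteratedFDeriv ℝ m (fun w => G (p.1, w)) p.2
      = (iteratedFDeriv ℝ m G p).compContinuousLinearMap
          fun _ => ContinuousLinearMap.inr ℝ ℝ E := by
  have h1 : ContDiffAt ℝ m (fun q => G ((p.1, 0) + q)) (0, p.2) := by
    refine ContDiffAt.comp (0, p.2) ?_ (contDiffAt_const.add contDiffAt_id)
    simpa using hG
  obtain ⟨s, hs, hsG⟩ := h1.contDiffOn le_rfl (by simp)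
  obtain ⟨o, hos, ho, hpo⟩ := mem_nhds_iff.1 (by simpa using hs : s ∈ 𝓝 ((0 : ℝ), p.2))
  have h2 := (ContinuousLinearMap.inr ℝ ℝ E).iteratedFDerivWithin_comp_right
    (hsG.mono hos) ho.uniqueDiffOn
    (ho.preimage (ContinuousLinearMap.inr ℝ ℝ E).continuous).uniqueDiffOn
    (x := p.2) hpo (le_refl (m : WithTop ℕ∞))
  rw [iteratedFDerivWithin_of_isOpen m (ho.preimage (ContinuousLinearMap.inr ℝ ℝ E).continuous) hpo,
    iteratedFDerivWithin_of_isOpen m ho (by exact hpo), iteratedFDeriv_comp_add_left] at h2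
  simpa [Function.comp_def] using h2

theorem continuousAt_iteratedFDeriv_partial {G : ℝ × E → F} {a : ℝ × E} (hG : ContDiffAt ℝ ∞ G a)
    (m : ℕ) : ContinuousAt (fun p : ℝ × E => iteratedFDeriv ℝ m (fun w => G (p.1, w)) p.2) a := by
  have hm : ContDiffAt ℝ m G a := hG.of_le (mod_cast le_top)
  have h1 : ∀ᶠ p in 𝓝 a, iteratedFDeriv ℝ m (fun w => G (p.1, w)) p.2
      = (iteratedFDeriv ℝ m G p).compContinuousLinearMap
          fun _ => ContinuousLinearMap.inr ℝ ℝ E := by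
    filter_upwards [hm.eventually (by simp)] with p hp using iteratedFDeriv_partial_eq hp
  refine ContinuousAt.congr ?_ (h1.mono fun _ h => h.symm)
  have h2 : ContinuousAt (iteratedFDeriv ℝ m G) a :=
    (hG.iteratedFDeriv_right (m := 0) (i := m) (by simpa using mod_cast le_top)).continuousAt
  exact (ContinuousMultilinearMap.compContinuousLinearMapL
    fun _ : Fin m => ContinuousLinearMap.inr ℝ ℝ E).continuous.continuousAt.comp h2

end PartialDerivatives

/-! ### Extending compactly supported maps of a chart to the manifold. -/

section ChartConjugation

/-- `f` maps `K` to itself and is the identity outside `K`. -/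
def SupportedOn {E : Type*} (K : Set E) (f : E → E) : Prop :=
  (∀ w, w ∉ K → f w = w) ∧ MapsTo f K K

theorem SupportedOn.mapsTo_of_subset {E : Type*} {K T : Set E} {f : E → E} (hf : SupportedOn K f)
    (hK : K ⊆ T) : MapsTo f T T := by
  intro w hw
  by_cases h : w ∈ K
  · exact hK (hf.2 h)
  · rwa [hf.1 w h]

/-- A point of `K` sent outside `K` would have the same image as that outside point, which is fixed.
-/
theorem supportedOn_of_injective {E : Type*} {f : E → E} (hf : Function.Injective f) {K : Set E}
    (h : ∀ w, w ∉ K → f w = w) : SupportedOn K f := by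
  refine ⟨h, fun w hw => ?_⟩
  by_contra hfw
  exact hfw (by rw [hf (h _ hfw)]; exact hw)

variable {c : ℕ} {M : Type u} [TopologicalSpace M] [ChartedSpace (EuclideanSpace ℝ (Fin c)) M]

open Classical in
/-- The map of `M` that is `f` in the chart at `x`, and the identity outside that chart. -/
def chartConj (x : M) (f : EuclideanSpace ℝ (Fin c) → EuclideanSpace ℝ (Fin c)) (y : M) : M :=
  if y ∈ (extChartAt (𝓡 c) x).source then (extChartAt (𝓡 c) x).symm (f (extChartAt (𝓡 c) x y))
  else y

theorem chartConj_of_mem {x : M} (f : EuclideanSpace ℝ (Fin c) → EuclideanSpace ℝ (Fin c)) {y : M}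
    (hy : y ∈ (extChartAt (𝓡 c) x).source) :
    chartConj x f y = (extChartAt (𝓡 c) x).symm (f (extChartAt (𝓡 c) x y)) := if_pos hy

theorem chartConj_of_notMem_source {x : M}
    (f : EuclideanSpace ℝ (Fin c) → EuclideanSpace ℝ (Fin c)) {y : M}
    (hy : y ∉ (extChartAt (𝓡 c) x).source) : chartConj x f y = y := if_neg hy

theorem chartConj_symm {x : M} (f : EuclideanSpace ℝ (Fin c) → EuclideanSpace ℝ (Fin c))
    {w : EuclideanSpace ℝ (Fin c)} (hw : w ∈ (extChartAt (𝓡 c) x).target) :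
    chartConj x f ((extChartAt (𝓡 c) x).symm w) = (extChartAt (𝓡 c) x).symm (f w) := by
  rw [chartConj_of_mem f ((extChartAt (𝓡 c) x).map_target hw),
    (extChartAt (𝓡 c) x).right_inv hw]

theorem chartConj_id (x y : M) :
    chartConj x (fun w : EuclideanSpace ℝ (Fin c) => w) y = y := by
  unfold chartConj
  split_ifs with h
  · exact (extChartAt (𝓡 c) x).left_inv h
  · rfl

theorem chartConj_chartConj {x : M} {K : Set (EuclideanSpace ℝ (Fin c))}
    (hK : K ⊆ (extChartAt (𝓡 c) x).target)
    {f g : EuclideanSpace ℝ (Fin c) → EuclideanSpace ℝ (Fin c)} (hg : SupportedOn K g) (y : M) :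
    chartConj x f (chartConj x g y) = chartConj x (fun w => f (g w)) y := by
  by_cases hy : y ∈ (extChartAt (𝓡 c) x).source
  · rw [chartConj_of_mem g hy, chartConj_of_mem _ hy, chartConj_symm]
    exact hg.mapsTo_of_subset hK ((extChartAt (𝓡 c) x).map_source hy)
  · simp only [chartConj_of_notMem_source _ hy]

theorem chartConj_of_notMem {x : M} {K : Set (EuclideanSpace ℝ (Fin c))}
    {f : EuclideanSpace ℝ (Fin c) → EuclideanSpace ℝ (Fin c)} (hf : SupportedOn K f) {y : M}
    (hy : y ∉ (extChartAt (𝓡 c) x).symm '' K) : chartConj x f y = y := by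
  by_cases h : y ∈ (extChartAt (𝓡 c) x).source
  · rw [chartConj_of_mem f h, hf.1, (extChartAt (𝓡 c) x).left_inv h]
    exact fun hK => hy ⟨_, hK, (extChartAt (𝓡 c) x).left_inv h⟩
  · exact chartConj_of_notMem_source f h

theorem isCompact_extChartAt_symm_image {x : M} {K : Set (EuclideanSpace ℝ (Fin c))}
    (hK : K ⊆ (extChartAt (𝓡 c) x).target) (hKc : IsCompact K) :
    IsCompact ((extChartAt (𝓡 c) x).symm '' K) :=
  hKc.image_of_continuousOn ((continuousOn_extChartAt_symm x).mono hK)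

variable [IsManifold (𝓡 c) ∞ M]

/-- The chart domain and the complement of the compact set carrying the support form an open cover.
On the first the map is a composition with charts, on the second it is the identity for all
parameters in the open set `T`. -/
theorem contMDiffAt_chartConj_family [T2Space M] {x : M} {K : Set (EuclideanSpace ℝ (Fin c))}
    (hK : K ⊆ (extChartAt (𝓡 c) x).target) (hKc : IsCompact K)
    {F : ℝ → EuclideanSpace ℝ (Fin c) → EuclideanSpace ℝ (Fin c)}
    (hF : ContDiff ℝ ∞ (fun q : ℝ × EuclideanSpace ℝ (Fin c) => F q.1 q.2)) {T : Set ℝ}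
    (hT : IsOpen T) (hs : ∀ t ∈ T, SupportedOn K (F t)) {t : ℝ} (ht : t ∈ T) (y : M) :
    ContMDiffAt (𝓘(ℝ, ℝ).prod (𝓡 c)) (𝓡 c) ∞
      (fun q : ℝ × M => chartConj x (F q.1) q.2) (t, y) := by
  by_cases hy : y ∈ (extChartAt (𝓡 c) x).source
  · have h1 : (fun q : ℝ × M => chartConj x (F q.1) q.2) =ᶠ[𝓝 (t, y)]
        fun q => (extChartAt (𝓡 c) x).symm (F q.1 (extChartAt (𝓡 c) x q.2)) := by
      have : ∀ᶠ q in 𝓝 (t, y), q.2 ∈ (extChartAt (𝓡 c) x).source :=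
        continuous_snd.continuousAt.preimage_mem_nhds (extChartAt_source_mem_nhds' hy)
      filter_upwards [this] with q hq using chartConj_of_mem _ hq
    refine ContMDiffAt.congr_of_eventuallyEq ?_ h1
    have hw : F t (extChartAt (𝓡 c) x y) ∈ (extChartAt (𝓡 c) x).target :=
      (hs t ht).mapsTo_of_subset hK ((extChartAt (𝓡 c) x).map_source hy)
    have h2 : ContMDiffAt 𝓘(ℝ, EuclideanSpace ℝ (Fin c)) (𝓡 c) ∞ (extChartAt (𝓡 c) x).symm
        (F t (extChartAt (𝓡 c) x y)) :=
      (contMDiffOn_extChartAt_symm x).contMDiffAt ((isOpen_extChartAt_target x).mem_nhds hw)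
    have h3 : ContMDiffAt (𝓘(ℝ, ℝ).prod (𝓡 c)) 𝓘(ℝ, EuclideanSpace ℝ (Fin c)) ∞
        (fun q : ℝ × M => extChartAt (𝓡 c) x q.2) (t, y) := by
      refine ContMDiffAt.comp (t, y) (contMDiffAt_extChartAt' ?_) contMDiffAt_snd
      simpa using hy
    have h4 : ContMDiffAt (𝓘(ℝ, ℝ).prod (𝓡 c)) 𝓘(ℝ, EuclideanSpace ℝ (Fin c)) ∞
        (fun q : ℝ × M => F q.1 (extChartAt (𝓡 c) x q.2)) (t, y) :=
      ContMDiffAt.comp (t, y) (f := fun q : ℝ × M => (q.1, extChartAt (𝓡 c) x q.2))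
        (g := fun q : ℝ × EuclideanSpace ℝ (Fin c) => F q.1 q.2)
        hF.contMDiff.contMDiffAt (contMDiffAt_fst.prodMk_space h3)
    exact ContMDiffAt.comp (t, y) (f := fun q : ℝ × M => F q.1 (extChartAt (𝓡 c) x q.2)) h2 h4
  · have hc : IsOpen ((extChartAt (𝓡 c) x).symm '' K)ᶜ :=
      (isCompact_extChartAt_symm_image hK hKc).isClosed.isOpen_compl
    have hyK : y ∈ ((extChartAt (𝓡 c) x).symm '' K)ᶜ := by
      rintro ⟨w, hw, rfl⟩
      exact hy ((extChartAt (𝓡 c) x).map_target (hK hw))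
    refine (contMDiffAt_snd (I := 𝓘(ℝ, ℝ))).congr_of_eventuallyEq ?_
    filter_upwards [(hT.prod hc).mem_nhds ⟨ht, hyK⟩] with q hq
    exact chartConj_of_notMem (hs q.1 hq.1) hq.2

theorem contMDiff_chartConj [T2Space M] {x : M} {K : Set (EuclideanSpace ℝ (Fin c))}
    (hK : K ⊆ (extChartAt (𝓡 c) x).target) (hKc : IsCompact K)
    {f : EuclideanSpace ℝ (Fin c) → EuclideanSpace ℝ (Fin c)} (hf : ContDiff ℝ ∞ f)
    (hs : SupportedOn K f) : ContMDiff (𝓡 c) (𝓡 c) ∞ (chartConj x f) := by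
  intro y
  have h1 := contMDiffAt_chartConj_family hK hKc (F := fun _ => f)
    (hf.comp contDiff_snd) isOpen_univ (fun _ _ => hs) (mem_univ 0) y
  exact ContMDiffAt.comp y (f := fun y : M => ((0 : ℝ), y)) h1
    (contMDiffAt_const.prodMk contMDiffAt_id)

/-- The diffeomorphism of `M` given by a pair of mutually inverse maps in a chart. -/
def chartDiffeomorph [T2Space M] (r : ℕ∞) {x : M} {K : Set (EuclideanSpace ℝ (Fin c))}
    (hK : K ⊆ (extChartAt (𝓡 c) x).target) (hKc : IsCompact K)
    {f g : EuclideanSpace ℝ (Fin c) → EuclideanSpace ℝ (Fin c)} (hf : ContDiff ℝ ∞ f)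
    (hg : ContDiff ℝ ∞ g) (hfs : SupportedOn K f) (hgs : SupportedOn K g)
    (hgf : ∀ w, g (f w) = w) (hfg : ∀ w, f (g w) = w) :
    M ≃ₘ^(r : WithTop ℕ∞)⟮𝓡 c, 𝓡 c⟯ M where
  toFun := chartConj x f
  invFun := chartConj x g
  left_inv y := by
    rw [chartConj_chartConj hK hfs]
    simp_rw [hgf]
    exact chartConj_id x y
  right_inv y := by
    rw [chartConj_chartConj hK hgs]
    simp_rw [hfg]
    exact chartConj_id x y
  contMDiff_toFun := (contMDiff_chartConj hK hKc hf hfs).of_le (mod_cast le_top)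
  contMDiff_invFun := (contMDiff_chartConj hK hKc hg hgs).of_le (mod_cast le_top)

/-- A reparametrized smooth family of diffeomorphisms with support in a compact set is an arc. -/
theorem isArc_of_contMDiffAt (r : ℕ∞) {f : ℝ≥0 → M ≃ₘ^(r : WithTop ℕ∞)⟮𝓡 c, 𝓡 c⟯ M}
    {g : ℝ → M → M} {θ : ℝ≥0 → ℝ} (hθ : Continuous θ) (hf : ∀ ε y, f ε y = g (θ ε) y)
    (hg : ∀ ε y, ContMDiffAt (𝓘(ℝ, ℝ).prod (𝓡 c)) (𝓡 c) ∞
      (fun q : ℝ × M => g q.1 q.2) (θ ε, y))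
    {K : Set M} (hK : IsCompact K) (hfK : ∀ ε, ∀ y ∉ K, f ε y = y) : IsArc c r f := by
  refine ⟨?_, ?_, fun ε₀ => ⟨K, hK, Eventually.of_forall fun ε y hy => ?_⟩⟩
  · refine continuous_iff_continuousAt.2 fun p => ?_
    simp_rw [hf]
    have h1 : ContinuousAt (fun p : ℝ≥0 × M => (θ p.1, p.2)) p := by fun_prop
    exact ContinuousAt.comp (f := fun p : ℝ≥0 × M => (θ p.1, p.2))
      (g := fun q : ℝ × M => g q.1 q.2) (hg p.1 p.2).continuousAt h1
  · intro ε₀ x₀ m _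
    simp_rw [hf]
    have h1 : ContMDiffAt 𝓘(ℝ, ℝ × EuclideanSpace ℝ (Fin c)) (𝓘(ℝ, ℝ).prod (𝓡 c)) ∞
        (fun q : ℝ × EuclideanSpace ℝ (Fin c) => (q.1, (extChartAt (𝓡 c) x₀).symm q.2))
        (θ ε₀, extChartAt (𝓡 c) x₀ x₀) := by
      refine contDiff_fst.contMDiff.contMDiffAt.prodMk ?_
      have h2 : ContMDiffAt 𝓘(ℝ, EuclideanSpace ℝ (Fin c)) (𝓡 c) ∞ (extChartAt (𝓡 c) x₀).symm
          (extChartAt (𝓡 c) x₀ x₀) :=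
        (contMDiffOn_extChartAt_symm x₀).contMDiffAt (extChartAt_target_mem_nhds x₀)
      exact ContMDiffAt.comp (θ ε₀, extChartAt (𝓡 c) x₀ x₀)
        (f := fun q : ℝ × EuclideanSpace ℝ (Fin c) => q.2) h2 contDiff_snd.contMDiff.contMDiffAt
    have h3 : ContMDiffAt 𝓘(ℝ, ℝ × EuclideanSpace ℝ (Fin c)) (𝓡 c) ∞
        (fun q : ℝ × EuclideanSpace ℝ (Fin c) => g q.1 ((extChartAt (𝓡 c) x₀).symm q.2))
        (θ ε₀, extChartAt (𝓡 c) x₀ x₀) := by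
      refine ContMDiffAt.comp _ (g := fun q : ℝ × M => g q.1 q.2) ?_ h1
      simpa using hg ε₀ x₀
    have h4 : ContDiffAt ℝ ∞ (fun q : ℝ × EuclideanSpace ℝ (Fin c) =>
        extChartAt (𝓡 c) (g (θ ε₀) x₀) (g q.1 ((extChartAt (𝓡 c) x₀).symm q.2)))
        (θ ε₀, extChartAt (𝓡 c) x₀ x₀) := by
      rw [← contMDiffAt_iff_contDiffAt]
      refine ContMDiffAt.comp _ (g := extChartAt (𝓡 c) (g (θ ε₀) x₀)) ?_ h3
      have h5 : g (θ ε₀, extChartAt (𝓡 c) x₀ x₀).1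
          ((extChartAt (𝓡 c) x₀).symm (θ ε₀, extChartAt (𝓡 c) x₀ x₀).2) = g (θ ε₀) x₀ := by simp
      rw [h5]
      exact contMDiffAt_extChartAt
    -- Only derivatives in `w` are taken, so a reparametrization `θ` that is merely continuous does
    -- no harm.
    exact ContinuousAt.comp (f := fun p : ℝ≥0 × EuclideanSpace ℝ (Fin c) => (θ p.1, p.2))
      (x := (ε₀, extChartAt (𝓡 c) x₀ x₀)) (continuousAt_iteratedFDeriv_partial h4 m)
      (by fun_prop)
  · rw [hfK ε y hy, hfK ε₀ y hy]

end ChartConjugation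

/-! ### Derivatives read through a fixed chart. -/

section ChartDerivative

variable {c : ℕ} {M : Type u} [TopologicalSpace M] [ChartedSpace (EuclideanSpace ℝ (Fin c)) M]
  [IsManifold (𝓡 c) ∞ M]

variable (c) in
/-- The derivative at `y` of the chart at `x`. -/
def chartDeriv (x y : M) : TangentSpace (𝓡 c) y →L[ℝ] EuclideanSpace ℝ (Fin c) :=
  (trivializationAt (EuclideanSpace ℝ (Fin c)) (TangentSpace (𝓡 c) : M → Type _)
    x).continuousLinearMapAt ℝ y

variable (c) in
/-- The derivative of the inverse of the chart at `x`, at the image of `y`. -/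
def chartSymmDeriv (x y : M) : EuclideanSpace ℝ (Fin c) →L[ℝ] TangentSpace (𝓡 c) y :=
  (trivializationAt (EuclideanSpace ℝ (Fin c)) (TangentSpace (𝓡 c) : M → Type _) x).symmL ℝ y

theorem chartSymmDeriv_chartDeriv {x y : M} (hy : y ∈ (extChartAt (𝓡 c) x).source)
    (v : TangentSpace (𝓡 c) y) : chartSymmDeriv c x y (chartDeriv c x y v) = v :=
  (trivializationAt (EuclideanSpace ℝ (Fin c)) (TangentSpace (𝓡 c) : M → Type _)
    x).symmL_continuousLinearMapAt (by simpa using hy) v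

theorem chartDeriv_chartSymmDeriv {x y : M} (hy : y ∈ (extChartAt (𝓡 c) x).source)
    (v : EuclideanSpace ℝ (Fin c)) : chartDeriv c x y (chartSymmDeriv c x y v) = v :=
  (trivializationAt (EuclideanSpace ℝ (Fin c)) (TangentSpace (𝓡 c) : M → Type _)
    x).continuousLinearMapAt_symmL (by simpa using hy) v

/-- The chain rule through the chart at `x`, for every base point `y` of its domain. Chart
derivatives are expressed by the trivialization of the tangent bundle at `x`, whose norms are
controlled near `x`. -/
theorem hasMFDerivAt_extChartAt_conj {x y : M} {φ : M → M}
    {A : EuclideanSpace ℝ (Fin c) → EuclideanSpace ℝ (Fin c)}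
    {L : EuclideanSpace ℝ (Fin c) →L[ℝ] EuclideanSpace ℝ (Fin c)}
    (hy : y ∈ (extChartAt (𝓡 c) x).source)
    (hφ : φ =ᶠ[𝓝 y] fun y' => (extChartAt (𝓡 c) x).symm (A (extChartAt (𝓡 c) x y')))
    (hA : HasFDerivAt A L (extChartAt (𝓡 c) x y))
    (hAy : A (extChartAt (𝓡 c) x y) ∈ (extChartAt (𝓡 c) x).target) :
    HasMFDerivAt (𝓡 c) (𝓡 c) φ y
      ((chartSymmDeriv c x (φ y)).comp (L.comp (chartDeriv c x y))) := by
  have hy' : y ∈ (chartAt (EuclideanSpace ℝ (Fin c)) x).source := by simpa using hy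
  have hφy := hφ.eq_of_nhds
  have hφs : φ y ∈ (extChartAt (𝓡 c) x).source := by
    rw [hφy]; exact (extChartAt (𝓡 c) x).map_target hAy
  have hφs' : φ y ∈ (chartAt (EuclideanSpace ℝ (Fin c)) x).source := by simpa using hφs
  have heφ : extChartAt (𝓡 c) x (φ y) = A (extChartAt (𝓡 c) x y) := by
    rw [hφy]; exact (extChartAt (𝓡 c) x).right_inv hAy
  have h1 : HasMFDerivAt (𝓡 c) 𝓘(ℝ, EuclideanSpace ℝ (Fin c)) (extChartAt (𝓡 c) x) y
      (chartDeriv c x y) := by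
    have := (mdifferentiableAt_extChartAt (I := 𝓡 c) hy').hasMFDerivAt
    rwa [← TangentBundle.continuousLinearMapAt_trivializationAt hy'] at this
  have h2 : HasMFDerivAt 𝓘(ℝ, EuclideanSpace ℝ (Fin c)) 𝓘(ℝ, EuclideanSpace ℝ (Fin c)) A
      (extChartAt (𝓡 c) x y) L := hA.hasMFDerivAt
  have h3 : HasMFDerivAt 𝓘(ℝ, EuclideanSpace ℝ (Fin c)) (𝓡 c) (extChartAt (𝓡 c) x).symm
      (extChartAt (𝓡 c) x (φ y)) (chartSymmDeriv c x (φ y)) := by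
    have h4 := (mdifferentiableWithinAt_extChartAt_symm (I := 𝓡 c) (x := x)
      ((extChartAt (𝓡 c) x).map_source hφs)).hasMFDerivWithinAt
    rw [← TangentBundle.symmL_trivializationAt hφs'] at h4
    have h5 : range (𝓡 c) = univ := ModelWithCorners.range_eq_univ _
    simp only [h5] at h4
    exact hasMFDerivWithinAt_univ.1 h4
  rw [heφ] at h3
  exact ((HasMFDerivAt.comp y h3 (HasMFDerivAt.comp y h2 h1))).congr_of_eventuallyEq hφ

end ChartDerivative

/-! ### Lipschitz constants for the Riemannian distance. -/

section Lipschitz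

variable {c : ℕ} {M : Type u} [EMetricSpace M] [ChartedSpace (EuclideanSpace ℝ (Fin c)) M]
  [Bundle.RiemannianBundle (fun x : M => TangentSpace (𝓡 c) x)]

/-- The distance is the infimum of lengths of $C^1$ paths, and `φ` multiplies lengths by at most
`K`. -/
theorem lipschitzWith_of_mfderiv_le [IsRiemannianManifold (𝓡 c) M] {φ : M → M}
    (hφ : ContMDiff (𝓡 c) (𝓡 c) 1 φ) {K : ℝ≥0}
    (hK0 : 0 < K) (hK : ∀ y, ‖mfderiv (𝓡 c) (𝓡 c) φ y‖ ≤ K) : LipschitzWith K φ := by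
  intro a b
  rw [IsRiemannianManifold.out (I := 𝓡 c) a b, IsRiemannianManifold.out (I := 𝓡 c) (φ a) (φ b)]
  have hK1 : (K : ℝ≥0∞) ≠ 0 := by simpa using hK0.ne'
  rw [mul_comm, ← ENNReal.div_le_iff hK1 ENNReal.coe_ne_top]
  refine le_of_forall_gt fun r hr => ?_
  obtain ⟨γ, rfl, rfl, hγ, hγr⟩ := Manifold.exists_lt_of_riemannianEDist_lt hr
  refine lt_of_le_of_lt ?_ hγr
  rw [ENNReal.div_le_iff hK1 ENNReal.coe_ne_top, mul_comm]
  refine (Manifold.riemannianEDist_le_pathELength (γ := φ ∘ γ) (hφ.comp_contMDiffOn hγ) rfl rfl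
    zero_le_one).trans ?_
  rw [Manifold.pathELength_eq_lintegral_mfderiv_Ioo, Manifold.pathELength_eq_lintegral_mfderiv_Ioo,
    ← MeasureTheory.lintegral_const_mul' _ _ ENNReal.coe_ne_top]
  refine MeasureTheory.setLIntegral_mono' measurableSet_Ioo fun t ht => ?_
  have h1 : MDifferentiableAt 𝓘(ℝ, ℝ) (𝓡 c) γ t :=
    (hγ.contMDiffAt (Icc_mem_nhds ht.1 ht.2)).mdifferentiableAt one_ne_zero
  have h2 : MDifferentiableAt (𝓡 c) (𝓡 c) φ (γ t) := (hφ _).mdifferentiableAt one_ne_zero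
  rw [mfderiv_comp t h2 h1]
  have h3 : ‖mfderiv (𝓡 c) (𝓡 c) φ (γ t)‖ₑ ≤ K := by
    rw [enorm_eq_nnnorm, ENNReal.coe_le_coe]
    exact hK _
  exact (ContinuousLinearMap.le_opENorm (mfderiv (𝓡 c) (𝓡 c) φ (γ t))
    (mfderiv 𝓘(ℝ, ℝ) (𝓡 c) γ t 1)).trans (mul_le_mul_left h3 _)

variable [IsManifold (𝓡 c) ∞ M]

/-- Write $L=1+(L-1)$. Inserting the chart derivative at `x` and its inverse factors the identity
part through $T_xM$ into two maps of norm at most `r`. The rest costs the crude chart constants, but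
it is multiplied by the small `η`. -/
theorem norm_comp_comp_le {x y y' : M} (hx : x ∈ (extChartAt (𝓡 c) x).source)
    {L : EuclideanSpace ℝ (Fin c) →L[ℝ] EuclideanSpace ℝ (Fin c)} {r C η : ℝ}
    (h1 : ‖(chartSymmDeriv c x x).comp (chartDeriv c x y)‖ ≤ r)
    (h2 : ‖(chartSymmDeriv c x y').comp (chartDeriv c x x)‖ ≤ r)
    (h3 : ‖chartDeriv c x y‖ ≤ C) (h4 : ‖chartSymmDeriv c x y'‖ ≤ C) (hL : ‖L - 1‖ ≤ η) :
    ‖(chartSymmDeriv c x y').comp (L.comp (chartDeriv c x y))‖ ≤ r * r + C * (η * C) := by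
  have hr := (ContinuousLinearMap.opNorm_nonneg _).trans h1
  have hC := (ContinuousLinearMap.opNorm_nonneg _).trans h3
  have hη := (norm_nonneg _).trans hL
  have e : (chartSymmDeriv c x y').comp (L.comp (chartDeriv c x y))
      = ((chartSymmDeriv c x y').comp (chartDeriv c x x)).comp
          ((chartSymmDeriv c x x).comp (chartDeriv c x y))
        + (chartSymmDeriv c x y').comp ((L - 1).comp (chartDeriv c x y)) := by
    ext v
    simp [chartDeriv_chartSymmDeriv hx]
  rw [e]
  refine (ContinuousLinearMap.opNorm_add_le _ _).trans (add_le_add ?_ ?_)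
  · exact (ContinuousLinearMap.opNorm_comp_le _ _).trans
      (mul_le_mul h2 h1 (ContinuousLinearMap.opNorm_nonneg _) hr)
  · refine (ContinuousLinearMap.opNorm_comp_le _ _).trans (mul_le_mul h4 ?_
      (ContinuousLinearMap.opNorm_nonneg _) hC)
    exact (ContinuousLinearMap.opNorm_comp_le _ _).trans (mul_le_mul hL h3
      (ContinuousLinearMap.opNorm_nonneg _) hη)


variable [IsContinuousRiemannianBundle (EuclideanSpace ℝ (Fin c))
  (fun x : M => TangentSpace (𝓡 c) x)]

theorem eventually_norm_chartDeriv_lt (x : M) :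
    ∃ C : ℝ, 0 < C ∧ ∀ᶠ y in 𝓝 x, ‖chartDeriv c x y‖ < C ∧ ‖chartSymmDeriv c x y‖ < C := by
  obtain ⟨C₁, h₁, H₁⟩ := eventually_norm_trivializationAt_lt (EuclideanSpace ℝ (Fin c))
    (fun x : M => TangentSpace (𝓡 c) x) x
  obtain ⟨C₂, h₂, H₂⟩ := eventually_norm_symmL_trivializationAt_lt (EuclideanSpace ℝ (Fin c))
    (fun x : M => TangentSpace (𝓡 c) x) x
  refine ⟨max C₁ C₂, lt_max_of_lt_left h₁, ?_⟩
  filter_upwards [H₁, H₂] with y h h'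
  exact ⟨lt_max_of_lt_left h, lt_max_of_lt_right h'⟩

theorem eventually_norm_chartSymmDeriv_comp_lt (x : M) {r : ℝ} (hr : 1 < r) :
    ∀ᶠ y in 𝓝 x, ‖(chartSymmDeriv c x x).comp (chartDeriv c x y)‖ < r ∧
      ‖(chartSymmDeriv c x y).comp (chartDeriv c x x)‖ < r :=
  (eventually_norm_symmL_trivializationAt_self_comp_lt (EuclideanSpace ℝ (Fin c))
    (fun x : M => TangentSpace (𝓡 c) x) x hr).and
  (eventually_norm_symmL_trivializationAt_comp_self_lt (EuclideanSpace ℝ (Fin c))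
    (fun x : M => TangentSpace (𝓡 c) x) x hr)

/-- In a small ball of the chart, maps close to the identity are almost isometric. -/
theorem exists_lipschitzWith_chartConj [IsRiemannianManifold (𝓡 c) M] (x : M) {K : ℝ≥0}
    (hK : 1 < K) :
    ∃ R > (0 : ℝ), Metric.closedBall (extChartAt (𝓡 c) x x) R ⊆ (extChartAt (𝓡 c) x).target ∧
      ∃ η : ℝ≥0, 0 < η ∧ ∀ f : EuclideanSpace ℝ (Fin c) → EuclideanSpace ℝ (Fin c),
        ContDiff ℝ ∞ f → SupportedOn (Metric.closedBall (extChartAt (𝓡 c) x x) R) f →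
        LipschitzWith η (fun w => f w - w) → LipschitzWith K (chartConj x f) := by
  have hK' : (1 : ℝ) < K := by exact_mod_cast hK
  -- The budget $K-1$ is halved: $r^2=1+(K-1)/2$ pays for the variation of the metric, and
  -- $\eta=(K-1)/(2C^2)$ makes $C\eta C=(K-1)/2$.
  set r : ℝ := √((1 + K) / 2) with hr
  have hrr : r * r = (1 + K) / 2 := Real.mul_self_sqrt (by positivity)
  have hr1 : 1 < r := by
    rw [hr, Real.lt_sqrt zero_le_one]
    linarith
  obtain ⟨C, hC, hCe⟩ := eventually_norm_chartDeriv_lt (c := c) x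
  have hev := hCe.and (eventually_norm_chartSymmDeriv_comp_lt (c := c) x hr1)
  have hcont : ContinuousAt (extChartAt (𝓡 c) x).symm (extChartAt (𝓡 c) x x) :=
    continuousAt_extChartAt_symm x
  have hev2 : ∀ᶠ w in 𝓝 (extChartAt (𝓡 c) x x), _ :=
    hcont.eventually (by rw [extChartAt_to_inv]; exact hev)
  obtain ⟨R, hR, hRs⟩ := Metric.nhds_basis_closedBall.mem_iff.1
    (hev2.and (extChartAt_target_mem_nhds x))
  have hRt : Metric.closedBall (extChartAt (𝓡 c) x x) R ⊆ (extChartAt (𝓡 c) x).target :=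
    fun w hw => (hRs hw).2
  refine ⟨R, hR, hRt, Real.toNNReal ((K - 1) / (2 * C * C)), ?_, fun f hf hfs hfL => ?_⟩
  · rw [Real.toNNReal_pos]
    have : 0 < (K : ℝ) - 1 := by linarith
    positivity
  set η : ℝ≥0 := Real.toNNReal ((K - 1) / (2 * C * C)) with hη
  have hηr : (η : ℝ) = (K - 1) / (2 * C * C) := by
    have : 0 < (K : ℝ) - 1 := by linarith
    rw [hη, Real.coe_toNNReal _ (by positivity)]
  have hKc := isCompact_closedBall (extChartAt (𝓡 c) x x) R
  have hsm := contMDiff_chartConj hRt hKc hf hfs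
  refine lipschitzWith_of_mfderiv_le (hsm.of_le (mod_cast le_top)) (zero_lt_one.trans hK)
    fun y => ?_
  by_cases hy : y ∈ (extChartAt (𝓡 c) x).symm '' Metric.closedBall (extChartAt (𝓡 c) x x) R
  · obtain ⟨w, hw, rfl⟩ := hy
    have hsrc := (extChartAt (𝓡 c) x).map_target (hRt hw)
    have hfw := hfs.2 hw
    have hew := (extChartAt (𝓡 c) x).right_inv (hRt hw)
    have hfd := (hf.differentiable (by simp) w).hasFDerivAt
    have hd := hasMFDerivAt_extChartAt_conj (φ := chartConj x f) (A := f) (L := fderiv ℝ f w)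
      hsrc (by
        filter_upwards [extChartAt_source_mem_nhds' hsrc] with y' hy'
        exact chartConj_of_mem f hy') (by rwa [hew]) (by rw [hew]; exact hRt hfw)
    rw [hd.mfderiv]
    have hb1 := (hRs hw).1
    have hb2 := (hRs hfw).1
    rw [← chartConj_symm f (hRt hw)] at hb2
    have hL : ‖fderiv ℝ f w - 1‖ ≤ η :=
      HasFDerivAt.le_of_lipschitz (hfd.sub (hasFDerivAt_id w)) hfL
    refine (norm_comp_comp_le (mem_extChartAt_source x) hb1.2.1.le hb2.2.2.le hb1.1.1.le
      hb2.1.2.le hL).trans ?_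
    rw [hrr, hηr]
    have : C * ((K - 1) / (2 * C * C) * C) = (K - 1) / 2 := by
      field_simp
    rw [this]
    linarith
  · have hc : IsOpen ((extChartAt (𝓡 c) x).symm ''
        Metric.closedBall (extChartAt (𝓡 c) x x) R)ᶜ :=
      (isCompact_extChartAt_symm_image hRt hKc).isClosed.isOpen_compl
    have he : chartConj x f =ᶠ[𝓝 y] id := by
      filter_upwards [hc.mem_nhds hy] with y' hy' using chartConj_of_notMem hfs hy'
    -- Near `y` the map is the identity, but its value at `y` equals `y` only propositionally, so
    -- the target fiber is another type. Writing the derivative in the chart at `y` lets `hz` carry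
    -- the norm across the equality.
    have hd := hasMFDerivAt_extChartAt_conj (φ := chartConj x f) (A := id) (mem_extChartAt_source y)
      (he.trans (by
        filter_upwards [extChartAt_source_mem_nhds (I := 𝓡 c) y] with y' hy'
        exact ((extChartAt (𝓡 c) y).left_inv hy').symm)) (hasFDerivAt_id _)
      ((extChartAt (𝓡 c) y).map_source (mem_extChartAt_source y))
    rw [hd.mfderiv]
    refine ContinuousLinearMap.opNorm_le_bound _ K.coe_nonneg fun v => ?_
    have hz : ∀ z : M, z = y → ‖chartSymmDeriv c y z (chartDeriv c y y v)‖ = ‖v‖ := by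
      rintro z rfl
      rw [chartSymmDeriv_chartDeriv (mem_extChartAt_source z)]
    refine (hz _ he.eq_of_nhds).le.trans ?_
    exact le_mul_of_one_le_left (norm_nonneg v) hK'.le

end Lipschitz

/-! ### Iterates of the skew-product, and transitivity of shifts. -/

section SkewProduct

variable {ι M : Type*}

theorem shiftEquiv_zpow_apply (n : ℤ) (ξ : ℤ → ι) (i : ℤ) :
    (shiftEquiv ι ^ n) ξ i = ξ (i + n) := by
  induction n using Int.induction_on generalizing i with
  | zero => simp
  | succ n ih =>
    rw [add_comm, zpow_add, zpow_one, Equiv.Perm.mul_apply]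
    change (shiftEquiv ι ^ (n : ℤ)) ξ (i + 1) = _
    rw [ih]
    congr 1
    ring
  | pred n ih =>
    rw [sub_eq_neg_add, zpow_add, zpow_neg_one, Equiv.Perm.mul_apply]
    change (shiftEquiv ι ^ (-n : ℤ)) ξ (i - 1) = _
    rw [ih]
    congr 1
    ring

theorem oneStep_zpow_fst (φ : ι → Equiv.Perm M) (n : ℤ) (ξ : ℤ → ι) (x : M) :
    ((oneStep φ ^ n) (ξ, x)).1 = (shiftEquiv ι ^ n) ξ := by
  induction n using Int.induction_on with
  | zero => simp
  | succ n ih =>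
    rw [add_comm, zpow_add, zpow_one, Equiv.Perm.mul_apply, zpow_add, zpow_one,
      Equiv.Perm.mul_apply, ← ih]
    rfl
  | pred n ih =>
    rw [sub_eq_neg_add, zpow_add, zpow_neg_one, Equiv.Perm.mul_apply, zpow_add, zpow_neg_one,
      Equiv.Perm.mul_apply, ← ih]
    rfl

@[simp]
theorem fiberMap_zero (φ : ι → Equiv.Perm M) (ξ : ℤ → ι) (x : M) : fiberMap φ 0 ξ x = x := by
  simp [fiberMap]

theorem fiberMap_add_one (φ : ι → Equiv.Perm M) (n : ℤ) (ξ : ℤ → ι) (x : M) :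
    fiberMap φ (n + 1) ξ x = φ (ξ n) (fiberMap φ n ξ x) := by
  have h : ((oneStep φ ^ n) (ξ, x)).1 0 = ξ n := by
    rw [oneStep_zpow_fst, shiftEquiv_zpow_apply, zero_add]
  rw [fiberMap, add_comm, zpow_add, zpow_one, Equiv.Perm.mul_apply, ← h]
  rfl

theorem fiberMap_sub_one (φ : ι → Equiv.Perm M) (n : ℤ) (ξ : ℤ → ι) (x : M) :
    fiberMap φ (n - 1) ξ x = (φ (ξ (n - 1))).symm (fiberMap φ n ξ x) := by
  rw [Equiv.eq_symm_apply, ← fiberMap_add_one, sub_add_cancel]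

theorem mem_maximalInvariantSet [TopologicalSpace M] {φ : ι → Equiv.Perm M} {D : Set M}
    {ξ : ℤ → ι} {x : M} :
    (ξ, x) ∈ maximalInvariantSet φ D ↔ ∀ n : ℤ, fiberMap φ n ξ x ∈ closure D := by
  rw [maximalInvariantSet, mem_iInter]
  constructor
  · intro h n
    obtain ⟨z, hz, hzx⟩ := h (-n)
    have : (oneStep φ ^ n) (ξ, x) = z := by
      rw [← hzx, ← Equiv.Perm.mul_apply, ← zpow_add, add_neg_cancel, zpow_zero]
      rfl
    rw [fiberMap, this]
    exact hz.2
  · intro h n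
    refine ⟨(oneStep φ ^ (-n)) (ξ, x), ⟨mem_univ _, h (-n)⟩, ?_⟩
    change (oneStep φ ^ n) ((oneStep φ ^ (-n)) (ξ, x)) = _
    rw [← Equiv.Perm.mul_apply, ← zpow_add, add_neg_cancel, zpow_zero]
    rfl

/-- The full shift is topologically transitive. -/
theorem exists_shiftEquiv_pow_mem {J : Type*} [TopologicalSpace J] {U V : Set (ℤ → J)}
    (hU : IsOpen U) (hV : IsOpen V) (hUn : U.Nonempty) (hVn : V.Nonempty) :
    ∃ b ∈ U, ∃ n : ℕ, (shiftEquiv J ^ (n : ℤ)) b ∈ V := by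
  obtain ⟨a, ha⟩ := hUn
  obtain ⟨b, hb⟩ := hVn
  obtain ⟨I, u, hu, huU⟩ := isOpen_pi_iff.1 hU a ha
  obtain ⟨I', u', hu', huV⟩ := isOpen_pi_iff.1 hV b hb
  obtain ⟨N, hN⟩ : ∃ N : ℕ, ∀ i ∈ I ∪ I', |i| ≤ N := by
    refine ⟨(I ∪ I').sup Int.natAbs, fun i hi => ?_⟩
    rw [Int.abs_eq_natAbs]
    exact_mod_cast Finset.le_sup (f := Int.natAbs) hi
  -- The relevant windows of `a` and `b` lie in $[-N,N]$. Shifting the second by $2N+1$ puts it in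
  -- $[N+1,3N+1]$, disjoint from the first.
  refine ⟨fun i => if i ≤ N then a i else b (i - (2 * N + 1)), huU fun i hi => ?_, 2 * N + 1,
    huV fun i hi => ?_⟩
  · have h1 := hN i (Finset.mem_union_left _ hi)
    have h2 : i ≤ N := (abs_le.1 h1).2
    simpa [h2] using (hu i hi).2
  · have h1 := (abs_le.1 (hN i (Finset.mem_union_right _ hi))).1
    rw [shiftEquiv_zpow_apply]
    have h2 : ¬ (i + ((2 * N + 1 : ℕ) : ℤ) ≤ N) := by push_cast; omega
    rw [if_neg h2]
    have h3 : i + ((2 * N + 1 : ℕ) : ℤ) - (2 * N + 1) = i := by push_cast; ring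
    rw [h3]
    exact (hu' i hi).2

/-- A continuous factor of a full shift is transitive. -/
theorem isTransitiveSet_range {X J : Type*} [TopologicalSpace X] [TopologicalSpace J]
    {Φ : Equiv.Perm X} {H : (ℤ → J) → X} (hH : Continuous H)
    (hΦ : ∀ b, Φ (H b) = H (shiftEquiv J b)) : IsTransitiveSet Φ (range H) := by
  have hpow : ∀ (n : ℕ) b, (Φ ^ n) (H b) = H ((shiftEquiv J ^ n) b) := by
    intro n
    induction n with
    | zero => intro b; rfl
    | succ n ih =>
      intro b
      rw [pow_succ, Equiv.Perm.mul_apply, hΦ, ih, pow_succ, Equiv.Perm.mul_apply]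
  rintro U V hU hV ⟨_, ⟨a, rfl⟩, ha⟩ ⟨_, ⟨b, rfl⟩, hb⟩
  obtain ⟨d, hd, n, hn⟩ := exists_shiftEquiv_pow_mem (hU.preimage hH) (hV.preimage hH)
    ⟨a, ha⟩ ⟨b, hb⟩
  refine ⟨n, H ((shiftEquiv J ^ n) d), ⟨H d, ⟨mem_range_self _, hd⟩, hpow n d⟩,
    mem_range_self _, ?_⟩
  rw [zpow_natCast] at hn
  exact hn

end SkewProduct

/-! ### Bounded solutions of the scalar hyperbolic recursion. -/

section ScalarRecursion

/-- The sign `±1` of a Boolean. -/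
def boolSign (b : Bool) : ℝ := if b then 1 else -1

theorem abs_boolSign (b : Bool) : |boolSign b| = 1 := by
  cases b <;> simp [boolSign]

/-- A bounded geometric series with coefficients read off a sequence of signs. -/
theorem summable_geometric_boolSign {q : ℝ} (hq0 : 0 ≤ q) (hq1 : q < 1) (β : ℕ → Bool) :
    Summable fun n => q ^ n * boolSign (β n) := by
  refine Summable.of_norm_bounded (summable_geometric_of_lt_one hq0 hq1) fun n => ?_
  rw [norm_mul, Real.norm_eq_abs (boolSign _), abs_boolSign, mul_one,
      Real.norm_of_nonneg (by positivity)]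

theorem abs_tsum_geometric_boolSign_le {q : ℝ} (hq0 : 0 ≤ q) (hq1 : q < 1) (β : ℕ → Bool) :
    |∑' n, q ^ n * boolSign (β n)| ≤ (1 - q)⁻¹ := by
  rw [← Real.norm_eq_abs]
  refine tsum_of_norm_bounded (hasSum_geometric_of_lt_one hq0 hq1) fun n => ?_
  rw [norm_mul, Real.norm_eq_abs (boolSign _), abs_boolSign, mul_one,
      Real.norm_of_nonneg (by positivity)]

theorem continuous_tsum_geometric_boolSign {X : Type*} [TopologicalSpace X] {q : ℝ} (hq0 : 0 ≤ q)
    (hq1 : q < 1) {β : X → ℕ → Bool} (hβ : ∀ n, Continuous fun x => β x n) :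
    Continuous fun x => ∑' n, q ^ n * boolSign (β x n) := by
  refine continuous_tsum (fun n => ?_) (summable_geometric_of_lt_one hq0 hq1) fun n x => ?_
  · exact continuous_const.mul ((continuous_of_discreteTopology (f := boolSign)).comp (hβ n))
  · rw [norm_mul, Real.norm_eq_abs (boolSign _), abs_boolSign, mul_one,
      Real.norm_of_nonneg (by positivity)]

theorem tsum_geometric_boolSign_eq {q : ℝ} (hq0 : 0 ≤ q) (hq1 : q < 1) (β : ℕ → Bool) :
    ∑' n, q ^ n * boolSign (β n) = boolSign (β 0) + q * ∑' n, q ^ n * boolSign (β (n + 1)) := by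
  rw [(summable_geometric_boolSign hq0 hq1 β).tsum_eq_zero_add, ← tsum_mul_left]
  simp [pow_succ', mul_assoc]

/-- The hyperbolic scalar recursion `y ↦ (1 ± δ) y + δ s`, driven by a sequence of signs `s`, has a
continuous bounded solution. -/
theorem exists_bounded_solution {δ : ℝ} (hδ0 : 0 < δ) (hδ1 : δ < 1) (stable : Prop)
    [Decidable stable] :
    ∃ H : (ℤ → Bool) → ℝ, Continuous H ∧ (∀ β, |H β| ≤ 1) ∧
      ∀ β, H (fun i => β (i + 1))
        = (if stable then 1 - δ else 1 + δ) * H β + δ * boolSign (β 0) := by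
  by_cases hs : stable
  · simp only [hs, if_true]
    have h0 : 0 ≤ 1 - δ := by linarith
    have h1 : 1 - δ < 1 := by linarith
    -- The contracting case is solved by summing over the past; the bound is
    -- $\delta\sum(1-\delta)^n=1$.
    refine ⟨fun β => δ * ∑' n : ℕ, (1 - δ) ^ n * boolSign (β (-1 - n)), ?_, fun β => ?_,
      fun β => ?_⟩
    · exact continuous_const.mul (continuous_tsum_geometric_boolSign h0 h1
        (β := fun (β : ℤ → Bool) (n : ℕ) => β (-1 - n)) fun n => continuous_apply _)
    · rw [abs_mul, abs_of_pos hδ0]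
      have := abs_tsum_geometric_boolSign_le h0 h1 fun n : ℕ => β (-1 - n)
      rw [sub_sub_cancel] at this
      calc _ ≤ δ * δ⁻¹ := mul_le_mul_of_nonneg_left this hδ0.le
        _ = 1 := mul_inv_cancel₀ hδ0.ne'
    · have key := tsum_geometric_boolSign_eq h0 h1 fun n : ℕ => β (-1 - n + 1)
      have : ∀ n : ℕ, (-1 - ((n + 1 : ℕ) : ℤ) + 1) = -1 - n := fun n => by push_cast; ring
      simp only [this, Nat.cast_zero, sub_zero, neg_add_cancel] at key
      beta_reduce
      rw [key]
      ring
  · simp only [hs, if_false]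
    have hp : 0 < 1 + δ := by linarith
    have h0 : 0 ≤ (1 + δ)⁻¹ := by positivity
    have h1 : (1 + δ)⁻¹ < 1 := inv_lt_one_of_one_lt₀ (by linarith)
    -- The expanding case is solved backwards, as $y=(1+\delta)^{-1}(y'-\delta s)$ with $y'$ the
    -- next value, which sums over the future from index $0$ on; the bound is again $1$.
    refine ⟨fun β => -(δ * (1 + δ)⁻¹) * ∑' n : ℕ, (1 + δ)⁻¹ ^ n * boolSign (β n), ?_,
      fun β => ?_, fun β => ?_⟩
    · exact continuous_const.mul (continuous_tsum_geometric_boolSign h0 h1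
        (β := fun (β : ℤ → Bool) (n : ℕ) => β n) fun n => continuous_apply _)
    · rw [abs_mul, abs_neg, abs_of_pos (by positivity)]
      have := abs_tsum_geometric_boolSign_le h0 h1 fun n : ℕ => β n
      calc _ ≤ δ * (1 + δ)⁻¹ * (1 - (1 + δ)⁻¹)⁻¹ := mul_le_mul_of_nonneg_left this (by positivity)
        _ = 1 := by
          have : 1 - (1 + δ)⁻¹ = δ * (1 + δ)⁻¹ := by field_simp; ring
          rw [this, mul_inv_cancel₀ (by positivity)]
    · have key := tsum_geometric_boolSign_eq h0 h1 fun n : ℕ => β n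
      simp only [Nat.cast_add, Nat.cast_one, Nat.cast_zero] at key
      beta_reduce
      rw [key]
      field_simp
      ring

/-- A bounded two-sided orbit of a linear map of the line without eigenvalue of modulus one is
zero. -/
theorem eq_zero_of_bounded_orbit {μ C : ℝ} (hμ0 : 0 < μ) (hμ1 : μ ≠ 1) {d : ℤ → ℝ}
    (hd : ∀ n, d (n + 1) = μ * d n) (hC : ∀ n, |d n| ≤ C) : d 0 = 0 := by
  have hz : ∀ n : ℕ, d n = μ ^ n * d 0 := by
    intro n
    induction n with
    | zero => simp
    | succ n ih => push_cast; rw [hd, ih, pow_succ']; ring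
  have hz' : ∀ n : ℕ, d 0 = μ ^ n * d (-n) := by
    intro n
    induction n with
    | zero => simp
    | succ n ih =>
      rw [ih, show (-(n : ℤ)) = -((n + 1 : ℕ) : ℤ) + 1 by push_cast; ring, hd, pow_succ]
      ring
  have key : ∀ q : ℝ, 0 ≤ q → q < 1 → (∀ n : ℕ, |d 0| ≤ q ^ n * C) → d 0 = 0 := by
    intro q h0 h1 h
    have ht : Tendsto (fun n : ℕ => q ^ n * C) atTop (𝓝 0) := by
      simpa using (tendsto_pow_atTop_nhds_zero_of_lt_one h0 h1).mul_const C
    exact abs_eq_zero.1 (le_antisymm (ge_of_tendsto' ht h) (abs_nonneg _))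
  rcases hμ1.lt_or_gt with h | h
  · refine key μ hμ0.le h fun n => ?_
    rw [hz' n, abs_mul, abs_of_pos (by positivity)]
    exact mul_le_mul_of_nonneg_left (hC _) (by positivity)
  · refine key μ⁻¹ (by positivity) (inv_lt_one_of_one_lt₀ h) fun n => ?_
    have h1 : d 0 = μ⁻¹ ^ n * d n := by
      rw [hz n, inv_pow, inv_mul_cancel_left₀ (by positivity)]
    rw [h1, abs_mul, abs_of_pos (by positivity)]
    exact mul_le_mul_of_nonneg_left (hC _) (by positivity)

end ScalarRecursion

/-! ### Coordinate cubes. -/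

section Cubes

variable {c : ℕ}

/-- The open cube with center `p` and half side `κ`. -/
def openCube (p : EuclideanSpace ℝ (Fin c)) (κ : ℝ) : Set (EuclideanSpace ℝ (Fin c)) :=
  {w | ∀ a, |w a - p a| < κ}

/-- The closed cube with center `p` and half side `κ`. -/
def closedCube (p : EuclideanSpace ℝ (Fin c)) (κ : ℝ) : Set (EuclideanSpace ℝ (Fin c)) :=
  {w | ∀ a, |w a - p a| ≤ κ}

theorem openCube_subset_closedCube (p : EuclideanSpace ℝ (Fin c)) (κ : ℝ) :
    openCube p κ ⊆ closedCube p κ := fun _ hw a => (hw a).le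

theorem closedCube_subset_openCube (p : EuclideanSpace ℝ (Fin c)) {κ κ' : ℝ} (h : κ < κ') :
    closedCube p κ ⊆ openCube p κ' := fun _ hw a => (hw a).trans_lt h

theorem closedCube_mono (p : EuclideanSpace ℝ (Fin c)) {κ κ' : ℝ} (h : κ ≤ κ') :
    closedCube p κ ⊆ closedCube p κ' := fun _ hw a => (hw a).trans h

theorem isOpen_openCube (p : EuclideanSpace ℝ (Fin c)) (κ : ℝ) : IsOpen (openCube p κ) := by
  rw [openCube, Set.ofPred_forall]
  exact isOpen_iInter_of_finite fun a => isOpen_lt (by fun_prop) continuous_const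

theorem norm_le_of_forall_abs_le {z : EuclideanSpace ℝ (Fin c)} {κ : ℝ} (hκ : 0 ≤ κ)
    (hz : ∀ a, |z a| ≤ κ) : ‖z‖ ≤ c * κ := by
  rw [EuclideanSpace.norm_eq, Real.sqrt_le_iff]
  refine ⟨by positivity, ?_⟩
  have h1 : ∑ a, ‖z a‖ ^ 2 ≤ ∑ _a : Fin c, κ ^ 2 :=
    Finset.sum_le_sum fun a _ => pow_le_pow_left₀ (norm_nonneg _) (hz a) 2
  refine h1.trans ?_
  simp only [Finset.sum_const, Finset.card_univ, Fintype.card_fin, nsmul_eq_mul]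
  rcases Nat.eq_zero_or_pos c with rfl | hc
  · simp
  · have : (1 : ℝ) ≤ c := by exact_mod_cast hc
    nlinarith [sq_nonneg κ, mul_nonneg (by linarith : (0:ℝ) ≤ c) (sq_nonneg κ)]

theorem closedCube_subset_closedBall (p : EuclideanSpace ℝ (Fin c)) {κ : ℝ} (hκ : 0 ≤ κ) :
    closedCube p κ ⊆ Metric.closedBall p (c * κ) := by
  intro w hw
  rw [mem_closedBall_iff_norm]
  exact norm_le_of_forall_abs_le hκ hw

theorem isCompact_closedCube (p : EuclideanSpace ℝ (Fin c)) (κ : ℝ) :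
    IsCompact (closedCube p κ) := by
  have hcl : IsClosed (closedCube p κ) := by
    rw [closedCube, Set.ofPred_forall]
    exact isClosed_iInter fun a => isClosed_le (by fun_prop) continuous_const
  refine (isCompact_closedBall p (c * |κ|)).of_isClosed_subset hcl ?_
  exact (closedCube_mono p (le_abs_self κ)).trans
    (closedCube_subset_closedBall p (abs_nonneg κ))

end Cubes

/-! ### Diagonal maps and coordinate subspaces. -/

section DiagonalMaps

variable {c : ℕ}

/-- The diagonal linear map with entries `m`. -/
def diagMap (m : Fin c → ℝ) : EuclideanSpace ℝ (Fin c) →L[ℝ] EuclideanSpace ℝ (Fin c) :=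
  LinearMap.toContinuousLinearMap
    { toFun := fun w => WithLp.toLp 2 fun a => m a * w a
      map_add' := fun w w' => by ext a; simp [mul_add]
      map_smul' := fun r w => by ext a; simp [mul_left_comm] }

@[simp]
theorem diagMap_apply (m : Fin c → ℝ) (w : EuclideanSpace ℝ (Fin c)) (a : Fin c) :
    diagMap m w a = m a * w a := rfl

theorem norm_diagMap_le {m : Fin c → ℝ} {K : ℝ} (hK : 0 ≤ K) {w : EuclideanSpace ℝ (Fin c)}
    (h : ∀ a, |m a * w a| ≤ K * |w a|) : ‖diagMap m w‖ ≤ K * ‖w‖ := by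
  rw [EuclideanSpace.norm_eq, EuclideanSpace.norm_eq, ← Real.sqrt_sq hK,
    ← Real.sqrt_mul (sq_nonneg K), Finset.mul_sum]
  refine Real.sqrt_le_sqrt (Finset.sum_le_sum fun a _ => ?_)
  rw [← mul_pow]
  exact pow_le_pow_left₀ (norm_nonneg _) (h a) 2

/-- The subspace of vectors whose coordinates outside `S` vanish. -/
def coordSubmodule (S : Finset (Fin c)) : Submodule ℝ (EuclideanSpace ℝ (Fin c)) where
  carrier := {w | ∀ a ∉ S, w a = 0}
  add_mem' h h' a ha := by simp [h a ha, h' a ha]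
  zero_mem' a _ := rfl
  smul_mem' r w h a ha := by simp [h a ha]

theorem finrank_coordSubmodule (S : Finset (Fin c)) :
    Module.finrank ℝ (coordSubmodule S) = S.card := by
  classical
  let L : coordSubmodule S ≃ₗ[ℝ] (S → ℝ) :=
    { toFun := fun w a => w.1 a
      map_add' := fun w w' => rfl
      map_smul' := fun r w => rfl
      invFun := fun f => ⟨WithLp.toLp 2 fun a => if h : a ∈ S then f ⟨a, h⟩ else 0,
        fun a ha => by simp [ha]⟩
      left_inv := fun w => by
        ext a
        by_cases h : a ∈ S
        · simp [h]
        · simp [h, w.2 a h]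
      right_inv := fun f => by ext a; simp }
  rw [L.finrank_eq]
  simp

theorem isCompl_coordSubmodule (S : Finset (Fin c)) :
    IsCompl (coordSubmodule S) (coordSubmodule Sᶜ) := by
  classical
  refine ⟨?_, ?_⟩
  · rw [Submodule.disjoint_def]
    intro w h h'
    ext a
    by_cases ha : a ∈ S
    · exact h' a (by simpa using ha)
    · exact h a ha
  · rw [codisjoint_iff, eq_top_iff]
    intro w _
    rw [Submodule.mem_sup]
    refine ⟨WithLp.toLp 2 fun a => if a ∈ S then w a else 0, fun a ha => by simp [ha],
      WithLp.toLp 2 fun a => if a ∈ S then 0 else w a, fun a ha => ?_, ?_⟩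
    · have : a ∈ S := by simpa using ha
      simp [this]
    · ext a
      by_cases ha : a ∈ S <;> simp [ha]

theorem map_diagMap_coordSubmodule {m : Fin c → ℝ} (hm : ∀ a, m a ≠ 0) (S : Finset (Fin c)) :
    (coordSubmodule S).map (diagMap m).toLinearMap = coordSubmodule S := by
  ext w
  constructor
  · rintro ⟨w', hw', rfl⟩ a ha
    have := hw' a ha
    simp [this]
  · intro hw
    refine ⟨diagMap (fun a => (m a)⁻¹) w, fun a ha => by simp [hw a ha], ?_⟩
    ext a
    simp [hm a]

end DiagonalMaps

/-! ### The affine model: conjugacy and covering. -/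

section BlenderMaps

variable {c : ℕ}

/-- The expansion rate of the `a`-th coordinate: `1 - δ` in the directions of `S`, and `1 + δ` in
the others. -/
def stretch (S : Finset (Fin c)) (δ : ℝ) (a : Fin c) : ℝ := if a ∈ S then 1 - δ else 1 + δ

/-- The affine map with linear part `diagMap (stretch S δ)` whose fixed point is a vertex of the
cube with center `p` and half side `6 u`. -/
def blenderMap (S : Finset (Fin c)) (δ u : ℝ) (p : EuclideanSpace ℝ (Fin c)) (b : Fin c → Bool)
    (w : EuclideanSpace ℝ (Fin c)) : EuclideanSpace ℝ (Fin c) :=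
  WithLp.toLp 2 fun a => p a + (stretch S δ a * (w a - p a) + δ * (6 * u) * boolSign (b a))

@[simp]
theorem blenderMap_apply (S : Finset (Fin c)) (δ u : ℝ) (p : EuclideanSpace ℝ (Fin c))
    (b : Fin c → Bool) (w : EuclideanSpace ℝ (Fin c)) (a : Fin c) :
    blenderMap S δ u p b w a
      = p a + (stretch S δ a * (w a - p a) + δ * (6 * u) * boolSign (b a)) := rfl

theorem stretch_pos (S : Finset (Fin c)) {δ : ℝ} (h0 : 0 < δ) (h1 : δ < 1) (a : Fin c) :
    0 < stretch S δ a := by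
  unfold stretch
  split_ifs <;> linarith

theorem stretch_ne_one (S : Finset (Fin c)) {δ : ℝ} (h0 : 0 < δ) (a : Fin c) :
    stretch S δ a ≠ 1 := by
  unfold stretch
  split_ifs <;> intro h <;> linarith

/-- The coordinates decouple. After division by $6u$ each one is the scalar recursion driven by its
own signs, whose solution is bounded by $1$. -/
theorem exists_conjugacy (S : Finset (Fin c)) {δ u : ℝ} (h0 : 0 < δ) (h1 : δ < 1) (hu : 0 < u)
    (p : EuclideanSpace ℝ (Fin c)) :
    ∃ h : (ℤ → Fin c → Bool) → EuclideanSpace ℝ (Fin c), Continuous h ∧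
      (∀ b, h b ∈ closedCube p (6 * u)) ∧
      ∀ b, h (shiftEquiv _ b) = blenderMap S δ u p (b 0) (h b) := by
  choose H hHc hHb hHr using fun a : Fin c => exists_bounded_solution h0 h1 (a ∈ S)
  refine ⟨fun b => WithLp.toLp 2 fun a => p a + 6 * u * H a fun i => b i a, ?_, fun b a => ?_,
    fun b => ?_⟩
  · refine (PiLp.continuous_toLp 2 _).comp (continuous_pi fun a => ?_)
    refine continuous_const.add (continuous_const.mul ((hHc a).comp ?_))
    exact continuous_pi fun i => (continuous_apply a).comp (continuous_apply i)
  · simp only [add_sub_cancel_left]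
    rw [abs_mul, abs_of_pos (by positivity)]
    exact mul_le_of_le_one_right (by positivity) (hHb a _)
  · ext a
    have := hHr a fun i => b i a
    simp only [blenderMap_apply, stretch, shiftEquiv, Equiv.coe_fn_mk]
    rw [this]
    ring

/-- Every point of the closed cube of half side `5 u` has a preimage in the open one. -/
theorem exists_blenderMap_preimage (S : Finset (Fin c)) {δ u : ℝ} (h0 : 0 < δ) (h1 : δ < 1 / 4)
    (hu : 0 < u) {p w : EuclideanSpace ℝ (Fin c)} (hw : w ∈ closedCube p (5 * u)) :
    ∃ b, ∃ w' ∈ openCube p (5 * u), blenderMap S δ u p b w' = w := by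
  -- The offset has the sign of the coordinate to be reached, so the preimage has first to undo a
  -- shift away from the center. At the far face $5u-6\delta u<(1-\delta)5u$, because $5<6$. The
  -- bound $\delta<1/4$ prevents overshooting the opposite face.
  let b : Fin c → Bool := fun a => decide (0 ≤ w a - p a)
  have hpos := stretch_pos S h0 (h1.trans (by norm_num))
  refine ⟨b, WithLp.toLp 2 fun a => p a + (w a - p a - δ * (6 * u) * boolSign (b a))
    / stretch S δ a, fun a => ?_, ?_⟩
  · simp only [add_sub_cancel_left]
    rw [abs_div, abs_of_pos (hpos a), div_lt_iff₀ (hpos a), abs_lt]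
    have h2 := abs_le.1 (hw a)
    have h3 : 0 < δ * u := mul_pos h0 hu
    have h4 : δ * u < 1 / 4 * u := mul_lt_mul_of_pos_right h1 hu
    by_cases hs : 0 ≤ w a - p a
    · have hb : boolSign (b a) = 1 := by simp only [boolSign, b, hs, decide_true, if_true]
      rw [hb, stretch]
      split_ifs <;> constructor <;> nlinarith
    · have hb : boolSign (b a) = -1 := by
        simp only [boolSign, b, hs, decide_false, if_neg Bool.false_ne_true]
      rw [hb, stretch]
      split_ifs <;> constructor <;> nlinarith
  · ext a
    have := (hpos a).ne'
    simp only [blenderMap_apply, add_sub_cancel_left]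
    field_simp
    ring

/-- Every point of the closed cube of half side `5 u` has an image in the open one. -/
theorem exists_blenderMap_mem (S : Finset (Fin c)) {δ u : ℝ} (h0 : 0 < δ) (h1 : δ < 1 / 4)
    (hu : 0 < u) {p w : EuclideanSpace ℝ (Fin c)} (hw : w ∈ closedCube p (5 * u)) :
    ∃ b, blenderMap S δ u p b w ∈ openCube p (5 * u) := by
  -- The offset now pushes toward the center: at worst $(1+\delta)5u-6\delta u=5u-\delta u$.
  let b : Fin c → Bool := fun a => decide (w a - p a < 0)
  refine ⟨b, fun a => ?_⟩
  simp only [blenderMap_apply, add_sub_cancel_left]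
  rw [abs_lt]
  have h2 := abs_le.1 (hw a)
  have h3 : 0 < δ * u := mul_pos h0 hu
  have h4 : δ * u < 1 / 4 * u := mul_lt_mul_of_pos_right h1 hu
  by_cases hs : w a - p a < 0
  · have hb : boolSign (b a) = 1 := by simp only [boolSign, b, hs, decide_true, if_true]
    have h5 : 0 ≤ δ * -(w a - p a) := mul_nonneg h0.le (by linarith)
    have h6 : δ * -(w a - p a) ≤ δ * (5 * u) := mul_le_mul_of_nonneg_left (by linarith) h0.le
    rw [hb, stretch]
    split_ifs <;> constructor <;> nlinarith
  · have hb : boolSign (b a) = -1 := by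
      simp only [boolSign, b, hs, decide_false, if_neg Bool.false_ne_true]
    have h5 : 0 ≤ δ * (w a - p a) := mul_nonneg h0.le (by linarith)
    have h6 : δ * (w a - p a) ≤ δ * (5 * u) := mul_le_mul_of_nonneg_left (by linarith) h0.le
    rw [hb, stretch]
    split_ifs <;> constructor <;> nlinarith

end BlenderMaps

/-! ### The maximal invariant set as a graph over a full shift. -/

section Blender

variable {c : ℕ} {ι : Type*} {M : Type u} [EMetricSpace M]
  [ChartedSpace (EuclideanSpace ℝ (Fin c)) M]

/-- In the chart at `x` and on a neighborhood `O` of the cube with center `p` and half side `7 u`,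
the maps `φ (v b)` are the affine maps `blenderMap S δ u p b`, while the other maps of the family
move the cube off itself. -/
structure IsAffineBlender (x : M) (φ : ι → Equiv.Perm M) (v : (Fin c → Bool) → ι)
    (S : Finset (Fin c)) (δ u : ℝ) (p : EuclideanSpace ℝ (Fin c))
    (O : Set (EuclideanSpace ℝ (Fin c))) : Prop where
  rate_pos : 0 < δ
  rate_lt : δ < 1 / 4
  size_pos : 0 < u
  isOpen : IsOpen O
  subset_target : O ⊆ (extChartAt (𝓡 c) x).target
  cube_subset : closedCube p (7 * u) ⊆ O
  mapsTo : ∀ b, MapsTo (blenderMap S δ u p b) O (extChartAt (𝓡 c) x).target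
  affine : ∀ b, ∀ w ∈ O, φ (v b) ((extChartAt (𝓡 c) x).symm w)
    = (extChartAt (𝓡 c) x).symm (blenderMap S δ u p b w)
  exit : ∀ i, i ∉ range v → ∀ w ∈ closedCube p (7 * u),
    φ i ((extChartAt (𝓡 c) x).symm w) ∉ (extChartAt (𝓡 c) x).symm '' closedCube p (7 * u)

/-- The preimage in the chart at `x` of the open cube with center `p` and half side `κ`. -/
def chartCube (x : M) (p : EuclideanSpace ℝ (Fin c)) (κ : ℝ) : Set M :=
  (extChartAt (𝓡 c) x).symm '' openCube p κ

theorem closure_chartCube_subset {x : M} {p : EuclideanSpace ℝ (Fin c)} {κ : ℝ}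
    (h : closedCube p κ ⊆ (extChartAt (𝓡 c) x).target) :
    closure (chartCube x p κ) ⊆ (extChartAt (𝓡 c) x).symm '' closedCube p κ :=
  closure_minimal (image_mono (openCube_subset_closedCube p κ))
    (isCompact_extChartAt_symm_image h (isCompact_closedCube p κ)).isClosed

theorem isOpen_chartCube {x : M} {p : EuclideanSpace ℝ (Fin c)} {κ : ℝ}
    (h : openCube p κ ⊆ (extChartAt (𝓡 c) x).target) : IsOpen (chartCube x p κ) := by
  have h1 : chartCube x p κ = (extChartAt (𝓡 c) x).source
      ∩ extChartAt (𝓡 c) x ⁻¹' openCube p κ := by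
    rw [chartCube, (extChartAt (𝓡 c) x).symm_image_eq_source_inter_preimage h]
  rw [h1]
  exact isOpen_extChartAt_preimage' x (isOpen_openCube p κ)

namespace IsAffineBlender

variable {x : M} {φ : ι → Equiv.Perm M} {v : (Fin c → Bool) → ι} {S : Finset (Fin c)} {δ u : ℝ}
  {p : EuclideanSpace ℝ (Fin c)} {O : Set (EuclideanSpace ℝ (Fin c))}

section

variable (H : IsAffineBlender x φ v S δ u p O)
include H

theorem cube_subset_target {κ : ℝ} (hκ : κ ≤ 7 * u) :
    closedCube p κ ⊆ (extChartAt (𝓡 c) x).target :=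
  (closedCube_mono p hκ).trans (H.cube_subset.trans H.subset_target)

theorem rate_lt_one : δ < 1 := H.rate_lt.trans (by norm_num)

end

end IsAffineBlender

theorem blenderMap_add_diagMap (S : Finset (Fin c)) (δ u : ℝ) (p : EuclideanSpace ℝ (Fin c))
    (b : Fin c → Bool) (w z : EuclideanSpace ℝ (Fin c)) :
    blenderMap S δ u p b (w + z) = blenderMap S δ u p b w + diagMap (stretch S δ) z := by
  ext a
  simp
  ring

/-- The affine conjugate of the fiber maps along the orbit of `h b`. -/
def affineIterate (S : Finset (Fin c)) (δ : ℝ)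
    (h : (ℤ → Fin c → Bool) → EuclideanSpace ℝ (Fin c)) (b : ℤ → Fin c → Bool) (n : ℤ)
    (w : EuclideanSpace ℝ (Fin c)) : EuclideanSpace ℝ (Fin c) :=
  h ((shiftEquiv _ ^ n) b) + diagMap (fun a => stretch S δ a ^ n) (w - h b)

theorem affineIterate_self (S : Finset (Fin c)) (δ : ℝ)
    (h : (ℤ → Fin c → Bool) → EuclideanSpace ℝ (Fin c)) (b : ℤ → Fin c → Bool) (n : ℤ) :
    affineIterate S δ h b n (h b) = h ((shiftEquiv _ ^ n) b) := by
  simp [affineIterate]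

theorem hasFDerivAt_affineIterate (S : Finset (Fin c)) (δ : ℝ)
    (h : (ℤ → Fin c → Bool) → EuclideanSpace ℝ (Fin c)) (b : ℤ → Fin c → Bool) (n : ℤ)
    (w : EuclideanSpace ℝ (Fin c)) :
    HasFDerivAt (affineIterate S δ h b n) (diagMap fun a => stretch S δ a ^ n) w := by
  unfold affineIterate
  exact (((diagMap fun a => stretch S δ a ^ n).hasFDerivAt).comp w
    ((hasFDerivAt_id w).sub_const _)).const_add _

theorem continuous_affineIterate (S : Finset (Fin c)) (δ : ℝ)
    (h : (ℤ → Fin c → Bool) → EuclideanSpace ℝ (Fin c)) (b : ℤ → Fin c → Bool) (n : ℤ) :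
    Continuous (affineIterate S δ h b n) :=
  continuous_iff_continuousAt.2 fun w => (hasFDerivAt_affineIterate S δ h b n w).continuousAt

theorem contDiff_affineIterate (S : Finset (Fin c)) (δ : ℝ)
    (h : (ℤ → Fin c → Bool) → EuclideanSpace ℝ (Fin c)) (b : ℤ → Fin c → Bool) (n : ℤ) :
    ContDiff ℝ ∞ (affineIterate S δ h b n) :=
  contDiff_const.add ((diagMap fun a => stretch S δ a ^ n).contDiff.comp
    (contDiff_id.sub contDiff_const))

/-- The cocycle relation holds for every `w` and every integer `n`, so it serves both forward and
backward induction; the offsets are absorbed by the orbit of `h`. -/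
theorem blenderMap_affineIterate {S : Finset (Fin c)} {δ u : ℝ} {p : EuclideanSpace ℝ (Fin c)}
    {h : (ℤ → Fin c → Bool) → EuclideanSpace ℝ (Fin c)} (h0 : 0 < δ) (h1 : δ < 1)
    (hh : ∀ b, h (shiftEquiv _ b) = blenderMap S δ u p (b 0) (h b)) (b : ℤ → Fin c → Bool) (n : ℤ)
    (w : EuclideanSpace ℝ (Fin c)) :
    blenderMap S δ u p (b n) (affineIterate S δ h b n w) = affineIterate S δ h b (n + 1) w := by
  have hb : ((shiftEquiv (Fin c → Bool) ^ n) b) 0 = b n := by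
    rw [shiftEquiv_zpow_apply, zero_add]
  rw [affineIterate, blenderMap_add_diagMap, affineIterate, add_comm n 1, zpow_add, zpow_one,
    Equiv.Perm.mul_apply, hh, hb]
  congr 1
  ext a
  simp only [diagMap_apply]
  rw [zpow_add₀ (stretch_pos S h0 h1 a).ne', zpow_one, mul_assoc]

namespace IsAffineBlender

variable {x : M} {φ : ι → Equiv.Perm M} {v : (Fin c → Bool) → ι} {S : Finset (Fin c)} {δ u : ℝ}
  {p : EuclideanSpace ℝ (Fin c)} {O : Set (EuclideanSpace ℝ (Fin c))}
  {h : (ℤ → Fin c → Bool) → EuclideanSpace ℝ (Fin c)}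

/-- An equality of germs, since the maps are affine only on `O`. The orbit of `h b` stays in the
cube of half side $6u$, inside `O`, so for each fixed `n` nearby points are still in `O`. The
backward step uses the affine formula one step earlier and inverts it. -/
theorem fiberMap_eventually_eq (H : IsAffineBlender x φ v S δ u p O)
    (hm : ∀ b, h b ∈ closedCube p (6 * u))
    (hh : ∀ b, h (shiftEquiv _ b) = blenderMap S δ u p (b 0) (h b)) (b : ℤ → Fin c → Bool) (n : ℤ) :
    ∀ᶠ w in 𝓝 (h b), fiberMap φ n (fun i => v (b i)) ((extChartAt (𝓡 c) x).symm w)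
      = (extChartAt (𝓡 c) x).symm (affineIterate S δ h b n w) := by
  have hO : ∀ b, O ∈ 𝓝 (h b) := fun b => H.isOpen.mem_nhds
    (H.cube_subset (closedCube_mono p (by linarith [H.size_pos]) (hm b)))
  have hA : ∀ n : ℤ, ∀ᶠ w in 𝓝 (h b), affineIterate S δ h b n w ∈ O := by
    intro n
    refine (continuous_affineIterate S δ h b n).continuousAt.preimage_mem_nhds ?_
    rw [affineIterate_self]
    exact hO _
  induction n using Int.induction_on with
  | zero =>
    filter_upwards with w
    simp [affineIterate, diagMap]
  | succ n ih =>
    filter_upwards [ih, hA n] with w hw hwO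
    rw [fiberMap_add_one, hw, H.affine _ _ hwO,
      blenderMap_affineIterate H.rate_pos H.rate_lt_one hh]
  | pred n ih =>
    filter_upwards [ih, hA (-n - 1)] with w hw hwO
    rw [fiberMap_sub_one, hw, Equiv.symm_apply_eq, H.affine _ _ hwO,
      blenderMap_affineIterate H.rate_pos H.rate_lt_one hh, sub_add_cancel]

theorem fiberMap_eq (H : IsAffineBlender x φ v S δ u p O)
    (hm : ∀ b, h b ∈ closedCube p (6 * u))
    (hh : ∀ b, h (shiftEquiv _ b) = blenderMap S δ u p (b 0) (h b)) (b : ℤ → Fin c → Bool) (n : ℤ) :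
    fiberMap φ n (fun i => v (b i)) ((extChartAt (𝓡 c) x).symm (h b))
      = (extChartAt (𝓡 c) x).symm (h ((shiftEquiv _ ^ n) b)) := by
  rw [(H.fiberMap_eventually_eq hm hh b n).self_of_nhds, affineIterate_self]

/-- The maximal invariant set in the cube is the graph of `h` over the sequences of the affine
symbols. -/
theorem maximalInvariantSet_eq (H : IsAffineBlender x φ v S δ u p O)
    (hm : ∀ b, h b ∈ closedCube p (6 * u))
    (hh : ∀ b, h (shiftEquiv _ b) = blenderMap S δ u p (b 0) (h b)) :
    maximalInvariantSet φ (chartCube x p (7 * u))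
      = range fun b : ℤ → Fin c → Bool =>
        ((fun i => v (b i), (extChartAt (𝓡 c) x).symm (h b)) : (ℤ → ι) × M) := by
  have hu := H.size_pos
  have hT := H.cube_subset_target le_rfl
  ext ⟨ξ, y⟩
  rw [mem_maximalInvariantSet]
  constructor
  · intro hξ
    have hξ' : ∀ n, ∃ w ∈ closedCube p (7 * u),
        (extChartAt (𝓡 c) x).symm w = fiberMap φ n ξ y :=
      fun n => closure_chartCube_subset hT (hξ n)
    choose w hw hwy using hξ'
    -- Any other symbol would throw the orbit out of the cube.
    have hv : ∀ n, ∃ b, v b = ξ n := by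
      intro n
      by_contra hn
      refine H.exit (ξ n) hn (w n) (hw n) ⟨w (n + 1), hw (n + 1), ?_⟩
      rw [hwy, hwy, fiberMap_add_one]
    choose b hb using hv
    have hwr : ∀ n, w (n + 1) = blenderMap S δ u p (b n) (w n) := by
      intro n
      have hO := H.cube_subset (hw n)
      have h1 := hwy (n + 1)
      rw [fiberMap_add_one, ← hwy, ← hb, H.affine _ _ hO] at h1
      -- The inverse chart is injective only on its target; the field `mapsTo` puts the affine image
      -- there.
      exact (extChartAt (𝓡 c) x).symm.injOn (hT (hw (n + 1))) (H.mapsTo _ hO) h1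
    have hw0 : w 0 = h b := by
      ext a
      rw [← sub_eq_zero]
      -- The difference of two orbits driven by the same signs satisfies the homogeneous recursion,
      -- and it is bounded by $7u+6u$.
      have := eq_zero_of_bounded_orbit (C := 13 * u)
        (d := fun n => w n a - h ((shiftEquiv _ ^ n) b) a)
        (stretch_pos S H.rate_pos H.rate_lt_one a) (stretch_ne_one S H.rate_pos a)
        (fun n => ?_) (fun n => ?_)
      · simpa using this
      · have hs : ((shiftEquiv (Fin c → Bool) ^ n) b) 0 = b n := by
          rw [shiftEquiv_zpow_apply, zero_add]
        rw [hwr, add_comm n 1, zpow_add, zpow_one, Equiv.Perm.mul_apply, hh, hs]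
        simp only [blenderMap_apply]
        ring
      · have h1 := abs_le.1 (hw n a)
        have h2 := abs_le.1 (hm ((shiftEquiv _ ^ n) b) a)
        rw [abs_le]
        constructor <;> linarith
    refine ⟨b, Prod.ext (funext hb) ?_⟩
    simp only
    rw [← hw0, hwy, fiberMap_zero]
  · rintro ⟨b, hb⟩ n
    rw [Prod.mk.injEq] at hb
    rw [← hb.1, ← hb.2, H.fiberMap_eq hm hh]
    exact subset_closure (mem_image_of_mem _
      (closedCube_subset_openCube p (by linarith) (hm _)))

theorem closure_subset_iUnion_image (H : IsAffineBlender x φ v S δ u p O) :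
    closure (chartCube x p (5 * u)) ⊆ ⋃ i, φ i '' chartCube x p (5 * u) := by
  have hu := H.size_pos
  intro y hy
  obtain ⟨w, hw, rfl⟩ := closure_chartCube_subset (H.cube_subset_target (by linarith)) hy
  obtain ⟨b, w', hw', rfl⟩ := exists_blenderMap_preimage S H.rate_pos H.rate_lt hu hw
  refine mem_iUnion.2 ⟨v b, (extChartAt (𝓡 c) x).symm w', mem_image_of_mem _ hw', ?_⟩
  exact H.affine b w' (H.cube_subset
    (closedCube_mono p (by linarith) (openCube_subset_closedCube p _ hw')))

theorem closure_subset_iUnion_symm_image (H : IsAffineBlender x φ v S δ u p O) :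
    closure (chartCube x p (5 * u)) ⊆ ⋃ i, (φ i).symm '' chartCube x p (5 * u) := by
  have hu := H.size_pos
  intro y hy
  obtain ⟨w, hw, rfl⟩ := closure_chartCube_subset (H.cube_subset_target (by linarith)) hy
  obtain ⟨b, hb⟩ := exists_blenderMap_mem S H.rate_pos H.rate_lt hu hw
  refine mem_iUnion.2 ⟨v b, _, mem_image_of_mem _ hb, ?_⟩
  rw [← H.affine b w (H.cube_subset (closedCube_mono p (by linarith) hw)),
    Equiv.symm_apply_apply]

variable [IsManifold (𝓡 c) ∞ M]

theorem hasMFDerivAt_fiberMap (H : IsAffineBlender x φ v S δ u p O)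
    (hm : ∀ b, h b ∈ closedCube p (6 * u))
    (hh : ∀ b, h (shiftEquiv _ b) = blenderMap S δ u p (b 0) (h b)) (b : ℤ → Fin c → Bool) (n : ℤ)
    {y : M} (hy : y = (extChartAt (𝓡 c) x).symm (h b)) :
    ContMDiffAt (𝓡 c) (𝓡 c) 1 (fiberMap φ n fun i => v (b i)) y ∧
    HasMFDerivAt (𝓡 c) (𝓡 c) (fiberMap φ n fun i => v (b i)) y
      ((chartSymmDeriv c x (fiberMap φ n (fun i => v (b i)) y)).comp
        ((diagMap fun a => stretch S δ a ^ n).comp (chartDeriv c x y))) := by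
  have hT : ∀ b, h b ∈ (extChartAt (𝓡 c) x).target := fun b =>
    H.cube_subset_target (by linarith [H.size_pos]) (hm b)
  have hys : y ∈ (extChartAt (𝓡 c) x).source := by
    rw [hy]; exact (extChartAt (𝓡 c) x).map_target (hT b)
  have hey : extChartAt (𝓡 c) x y = h b := by
    rw [hy]; exact (extChartAt (𝓡 c) x).right_inv (hT b)
  have hev : (fiberMap φ n fun i => v (b i)) =ᶠ[𝓝 y] fun y' =>
      (extChartAt (𝓡 c) x).symm (affineIterate S δ h b n (extChartAt (𝓡 c) x y')) := by
    have h1 := (continuousAt_extChartAt' hys).eventually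
      (by rw [hey]; exact H.fiberMap_eventually_eq hm hh b n)
    filter_upwards [h1, extChartAt_source_mem_nhds' hys] with y' hy' hys'
    rwa [(extChartAt (𝓡 c) x).left_inv hys'] at hy'
  have hAT : affineIterate S δ h b n (extChartAt (𝓡 c) x y) ∈ (extChartAt (𝓡 c) x).target := by
    rw [hey, affineIterate_self]; exact hT _
  refine ⟨ContMDiffAt.congr_of_eventuallyEq ?_ hev, hasMFDerivAt_extChartAt_conj hys hev
    (hasFDerivAt_affineIterate S δ h b n _) hAT⟩
  have h1 : ContMDiffAt 𝓘(ℝ, EuclideanSpace ℝ (Fin c)) (𝓡 c) ∞ (extChartAt (𝓡 c) x).symm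
      (affineIterate S δ h b n (extChartAt (𝓡 c) x y)) :=
    (contMDiffOn_extChartAt_symm x).contMDiffAt ((isOpen_extChartAt_target x).mem_nhds hAT)
  have h2 : ContMDiffAt (𝓡 c) 𝓘(ℝ, EuclideanSpace ℝ (Fin c)) ∞ (extChartAt (𝓡 c) x) y :=
    contMDiffAt_extChartAt' (by simpa using hys)
  have h3 : ContMDiffAt (𝓡 c) 𝓘(ℝ, EuclideanSpace ℝ (Fin c)) ∞
      (fun y' => affineIterate S δ h b n (extChartAt (𝓡 c) x y')) y :=
    ContMDiffAt.comp y (g := affineIterate S δ h b n) (f := extChartAt (𝓡 c) x)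
      (contDiff_affineIterate S δ h b n).contMDiff.contMDiffAt h2
  exact (ContMDiffAt.comp y h1 h3).of_le (mod_cast le_top)

end IsAffineBlender

variable [IsManifold (𝓡 c) ∞ M]

variable (c) in
/-- The derivative of the chart at `x` as a linear equivalence. -/
def chartDerivEquiv {x y : M} (hy : y ∈ (extChartAt (𝓡 c) x).source) :
    EuclideanSpace ℝ (Fin c) ≃ₗ[ℝ] TangentSpace (𝓡 c) y :=
  LinearEquiv.ofLinearMap (chartSymmDeriv c x y).toLinearMap (chartDeriv c x y).toLinearMap
    (LinearMap.ext (chartSymmDeriv_chartDeriv hy)) (LinearMap.ext (chartDeriv_chartSymmDeriv hy))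

/-- The subspace of `T_y M` spanned by the coordinate directions of the chart at `x` in `S`. -/
def coordDistribution (x : M) (S : Finset (Fin c)) (y : M) :
    Submodule ℝ (TangentSpace (𝓡 c) y) :=
  (coordSubmodule S).map (chartSymmDeriv c x y).toLinearMap

theorem coordDistribution_eq {x y : M} (hy : y ∈ (extChartAt (𝓡 c) x).source)
    (S : Finset (Fin c)) : coordDistribution x S y
      = (coordSubmodule S).map (chartDerivEquiv c hy).toLinearMap := rfl

theorem finrank_coordDistribution {x y : M} (hy : y ∈ (extChartAt (𝓡 c) x).source)
    (S : Finset (Fin c)) : Module.finrank ℝ (coordDistribution x S y) = S.card := by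
  rw [coordDistribution_eq hy, LinearEquiv.finrank_map_eq, finrank_coordSubmodule]

theorem isCompl_coordDistribution {x y : M} (hy : y ∈ (extChartAt (𝓡 c) x).source)
    (S : Finset (Fin c)) :
    IsCompl (coordDistribution x S y) (coordDistribution x Sᶜ y) := by
  rw [coordDistribution_eq hy, coordDistribution_eq hy]
  exact (Submodule.orderIsoMapComap (chartDerivEquiv c hy)).isCompl (isCompl_coordSubmodule S)

theorem chartDeriv_mem_of_mem_coordDistribution {x y : M}
    (hy : y ∈ (extChartAt (𝓡 c) x).source) {S : Finset (Fin c)} {w : TangentSpace (𝓡 c) y}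
    (hw : w ∈ coordDistribution x S y) : chartDeriv c x y w ∈ coordSubmodule S := by
  obtain ⟨z, hz, rfl⟩ := hw
  change chartDeriv c x y (chartSymmDeriv c x y z) ∈ _
  rwa [chartDeriv_chartSymmDeriv hy]

/-- Diagonal maps preserve coordinate subspaces. As the same chart is used at both ends, the
coordinate distributions are invariant along orbits. -/
theorem map_coordDistribution {x y y' : M} (hy : y ∈ (extChartAt (𝓡 c) x).source)
    {m : Fin c → ℝ} (hm : ∀ a, m a ≠ 0) (S : Finset (Fin c)) :
    (coordDistribution x S y).map
      ((chartSymmDeriv c x y').comp ((diagMap m).comp (chartDeriv c x y))).toLinearMap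
      = coordDistribution x S y' := by
  have h1 := map_diagMap_coordSubmodule hm S
  ext w
  constructor
  · rintro ⟨_, ⟨z, hz, rfl⟩, rfl⟩
    refine ⟨diagMap m z, h1 ▸ Submodule.mem_map_of_mem hz, ?_⟩
    change chartSymmDeriv c x y' (diagMap m z)
      = chartSymmDeriv c x y' (diagMap m (chartDeriv c x y (chartSymmDeriv c x y z)))
    rw [chartDeriv_chartSymmDeriv hy]
  · rintro ⟨z, hz, rfl⟩
    have hz' : z ∈ (coordSubmodule S).map (diagMap m).toLinearMap := by rw [h1]; exact hz
    obtain ⟨z', hz'', rfl⟩ := hz'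
    refine ⟨_, ⟨z', hz'', rfl⟩, ?_⟩
    change chartSymmDeriv c x y' (diagMap m (chartDeriv c x y (chartSymmDeriv c x y z')))
      = chartSymmDeriv c x y' (diagMap m z')
    rw [chartDeriv_chartSymmDeriv hy]

end Blender

/-! ### Hyperbolicity and blending. -/

section BlendingRegions

variable {c : ℕ} {ι : Type*} {M : Type u} [EMetricSpace M]
  [ChartedSpace (EuclideanSpace ℝ (Fin c)) M] [IsManifold (𝓡 c) ∞ M]
  [Bundle.RiemannianBundle (fun x : M => TangentSpace (𝓡 c) x)]

/-- A whole iterate is one diagonal map between two chart derivatives, so the factor $C^2$ is paid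
once and not at every step. -/
theorem norm_mfderiv_le_of_factor {x y y' : M}
    (hy : y ∈ (extChartAt (𝓡 c) x).source) {S : Finset (Fin c)} {m : Fin c → ℝ} {K C : ℝ}
    (hK : 0 ≤ K) (hm : ∀ a ∈ S, |m a| ≤ K)
    (h1 : ‖chartDeriv c x y‖ ≤ C) (h2 : ‖chartSymmDeriv c x y'‖ ≤ C)
    {w : TangentSpace (𝓡 c) y} (hw : w ∈ coordDistribution x S y) :
    ‖(chartSymmDeriv c x y').comp ((diagMap m).comp (chartDeriv c x y)) w‖ ≤ C * C * K * ‖w‖ := by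
  have hC : 0 ≤ C := (ContinuousLinearMap.opNorm_nonneg _).trans h1
  have hw' := chartDeriv_mem_of_mem_coordDistribution hy hw
  have h3 : ‖chartDeriv c x y w‖ ≤ C * ‖w‖ :=
    (ContinuousLinearMap.le_opNorm _ _).trans (mul_le_mul_of_nonneg_right h1 (norm_nonneg _))
  have h4 : ‖diagMap m (chartDeriv c x y w)‖ ≤ K * ‖chartDeriv c x y w‖ := by
    refine norm_diagMap_le hK fun a => ?_
    by_cases ha : a ∈ S
    · rw [abs_mul]
      exact mul_le_mul_of_nonneg_right (hm a ha) (abs_nonneg _)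
    · rw [hw' a ha]
      simp
  calc ‖chartSymmDeriv c x y' (diagMap m (chartDeriv c x y w))‖
      ≤ ‖chartSymmDeriv c x y'‖ * ‖diagMap m (chartDeriv c x y w)‖ :=
        ContinuousLinearMap.le_opNorm _ _
    _ ≤ C * (K * (C * ‖w‖)) := by
        refine mul_le_mul h2 (h4.trans ?_) (norm_nonneg _) hC
        exact mul_le_mul_of_nonneg_left h3 hK
    _ = C * C * K * ‖w‖ := by ring

namespace IsAffineBlender

variable [TopologicalSpace ι] {x : M} {φ : ι → Equiv.Perm M} {v : (Fin c → Bool) → ι}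
  {S : Finset (Fin c)} {δ u : ℝ} {p : EuclideanSpace ℝ (Fin c)} {O : Set (EuclideanSpace ℝ (Fin c))}

/-- The graph map from the full shift is continuous and equivariant, which gives compactness,
invariance and transitivity. The splitting is by the coordinates in `S` and in its complement,
independently of the sequence. -/
theorem isHyperbolicSet_and_isTransitiveSet (H : IsAffineBlender x φ v S δ u p O) {C : ℝ}
    (hC : ∀ w ∈ closedCube p (7 * u), ‖chartDeriv c x ((extChartAt (𝓡 c) x).symm w)‖ ≤ C ∧
      ‖chartSymmDeriv c x ((extChartAt (𝓡 c) x).symm w)‖ ≤ C) :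
    IsHyperbolicSet c φ (maximalInvariantSet φ (chartCube x p (7 * u))) S.card (Sᶜ).card ∧
    IsTransitiveSet (oneStep φ) (maximalInvariantSet φ (chartCube x p (7 * u))) := by
  have hu := H.size_pos
  have hδ := H.rate_pos
  have hδ1 := H.rate_lt_one
  obtain ⟨h, hc, hm, hh⟩ := exists_conjugacy S hδ hδ1 hu p
  rw [H.maximalInvariantSet_eq hm hh]
  have hm7 : ∀ b, h b ∈ closedCube p (7 * u) := fun b => closedCube_mono p (by linarith) (hm b)
  have hT : ∀ b, h b ∈ (extChartAt (𝓡 c) x).target := fun b => H.cube_subset_target le_rfl (hm7 b)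
  set G : (ℤ → Fin c → Bool) → (ℤ → ι) × M :=
    fun b => (fun i => v (b i), (extChartAt (𝓡 c) x).symm (h b)) with hG
  have hGc : Continuous G := by
    refine Continuous.prodMk (continuous_pi fun i => ?_) ?_
    · exact continuous_of_discreteTopology.comp (continuous_apply i)
    · exact (continuousOn_extChartAt_symm x).comp_continuous hc hT
  have hstep : ∀ b, oneStep φ (G b) = G (shiftEquiv _ b) := by
    intro b
    refine Prod.ext rfl ?_
    change φ (v (b 0)) ((extChartAt (𝓡 c) x).symm (h b)) = (extChartAt (𝓡 c) x).symm (h _)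
    rw [H.affine _ _ (H.cube_subset (hm7 b)), hh]
  refine ⟨⟨range_nonempty G, isCompact_range hGc, ?_, ?_, ?_⟩, isTransitiveSet_range hGc hstep⟩
  · rw [← range_comp]
    have : oneStep φ ∘ G = G ∘ shiftEquiv _ := funext hstep
    rw [this, (shiftEquiv _).surjective.range_comp]
  · rintro n ξ y ⟨b, hb⟩
    rw [hG, Prod.mk.injEq] at hb
    obtain ⟨rfl, rfl⟩ := hb
    exact (H.hasMFDerivAt_fiberMap hm hh b n rfl).1
  -- A common rate for both bundles: $1-\delta\le(1+\delta)^{-1}$. The maximum with $1$ makes the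
  -- constant positive.
  · refine ⟨fun _ => coordDistribution x S, fun _ => coordDistribution x Sᶜ, max (C * C) 1,
      (1 + δ)⁻¹, by positivity, by positivity, inv_lt_one_of_one_lt₀ (by linarith), ?_⟩
    rintro ξ y ⟨b, hb⟩
    rw [hG, Prod.mk.injEq] at hb
    obtain ⟨rfl, rfl⟩ := hb
    have hys : (extChartAt (𝓡 c) x).symm (h b) ∈ (extChartAt (𝓡 c) x).source :=
      (extChartAt (𝓡 c) x).map_target (hT b)
    have hd := fun n => (H.hasMFDerivAt_fiberMap hm hh b n rfl).2
    have hφ1 : φ (v (b 0)) = fiberMap φ 1 fun i => v (b i) := by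
      funext y
      have := fiberMap_add_one φ 0 (fun i => v (b i)) y
      rw [fiberMap_zero] at this
      exact this.symm
    have hst : ∀ (n : ℤ) a, stretch S δ a ^ n ≠ 0 := fun n a =>
      zpow_ne_zero _ (stretch_pos S hδ hδ1 a).ne'
    -- The target fiber of `mfderiv` depends on the map, so the map is made a variable `ψ` and
    -- eliminated by substitution.
    have hinv : ∀ ψ : M → M, ψ = (fiberMap φ 1 fun i => v (b i)) → ∀ S' : Finset (Fin c),
        (coordDistribution x S' ((extChartAt (𝓡 c) x).symm (h b))).map
          (mfderiv (𝓡 c) (𝓡 c) ψ ((extChartAt (𝓡 c) x).symm (h b))).toLinearMap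
          = coordDistribution x S' (ψ ((extChartAt (𝓡 c) x).symm (h b))) := by
      rintro ψ rfl S'
      rw [(hd 1).mfderiv]
      exact map_coordDistribution hys (hst 1) S'
    have hCb := hC _ (hm7 b)
    have hCn : ∀ n : ℤ, ‖chartSymmDeriv c x (fiberMap φ n (fun i => v (b i))
        ((extChartAt (𝓡 c) x).symm (h b)))‖ ≤ C := by
      intro n
      rw [H.fiberMap_eq hm hh]
      exact (hC _ (hm7 _)).2
    have hlam : 0 < 1 + δ := by linarith
    refine ⟨isCompl_coordDistribution hys S, finrank_coordDistribution hys S,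
      finrank_coordDistribution hys Sᶜ, ?_, ?_, fun n w hw => ?_, fun n w hw => ?_⟩
    · exact hinv _ hφ1 S
    · exact hinv _ hφ1 Sᶜ
    · rw [(hd n).mfderiv]
      refine (norm_mfderiv_le_of_factor hys (K := (1 + δ)⁻¹ ^ n) (by positivity) (fun a ha => ?_)
        hCb.1 (hCn n) hw).trans ?_
      · rw [stretch, if_pos ha, zpow_natCast, abs_of_nonneg (pow_nonneg (by linarith) n)]
        refine pow_le_pow_left₀ (by linarith) ?_ n
        rw [le_inv_comm₀ (by linarith) hlam, ← one_div, le_div_iff₀ (by linarith)]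
        nlinarith
      · gcongr
        exact le_max_left _ _
    · rw [(hd (-n)).mfderiv]
      refine (norm_mfderiv_le_of_factor hys (K := (1 + δ)⁻¹ ^ n) (by positivity) (fun a ha => ?_)
        hCb.1 (hCn (-n)) hw).trans ?_
      · have ha' : a ∉ S := by simpa using ha
        rw [stretch, if_neg ha', zpow_neg, zpow_natCast, inv_pow, abs_of_nonneg (by positivity)]
      · gcongr
        exact le_max_left _ _

theorem isBlendingPair (H : IsAffineBlender x φ v S δ u p O) {C : ℝ}
    (hC : ∀ w ∈ closedCube p (7 * u), ‖chartDeriv c x ((extChartAt (𝓡 c) x).symm w)‖ ≤ C ∧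
      ‖chartSymmDeriv c x ((extChartAt (𝓡 c) x).symm w)‖ ≤ C)
    (hbd : Metric.ediam (chartCube x p (7 * u)) ≠ ⊤) :
    IsBlendingPair c φ (chartCube x p (5 * u)) (chartCube x p (7 * u)) S.card (Sᶜ).card := by
  have hu := H.size_pos
  have hsub : closure (chartCube x p (5 * u)) ⊆ chartCube x p (7 * u) :=
    (closure_chartCube_subset (H.cube_subset_target (by linarith))).trans
      (image_mono (closedCube_subset_openCube p (by linarith)))
  refine ⟨isOpen_chartCube ((openCube_subset_closedCube p _).trans
    (H.cube_subset_target (by linarith))), isOpen_chartCube ((openCube_subset_closedCube p _).trans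
    (H.cube_subset_target le_rfl)), ?_, hbd, hsub, H.isHyperbolicSet_and_isTransitiveSet hC⟩
  exact ne_top_of_le_ne_top hbd (Metric.ediam_mono (subset_closure.trans hsub))

end IsAffineBlender

end BlendingRegions

/-! ### Flat perturbations of the identity at scale $t$. -/

section FlatPerturbation

variable {E : Type*} [NormedAddCommGroup E] [NormedSpace ℝ E]

theorem expNegInvGlue_le_one (t : ℝ) : expNegInvGlue t ≤ 1 := by
  unfold expNegInvGlue
  split_ifs with h
  · exact zero_le_one
  · exact Real.exp_le_one_iff.2 (by simpa using (not_le.1 h).le)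

/-- The perturbation of the identity by the fields `A` and `A'`, rescaled to the ball with center
`w₀` and radius `t`, with amplitudes that are flat at `t = 0`. -/
def flatPerturbation (κ : ℝ) (w₀ : E) (A A' : E → E) (t : ℝ) (w : E) : E :=
  w + ((κ * t) • (expNegInvGlue t • A (t⁻¹ • (w - w₀)))
    + (κ * t * (κ * expNegInvGlue t)) • (expNegInvGlue t • A' (t⁻¹ • (w - w₀))))

theorem flatPerturbation_eq (κ : ℝ) (w₀ : E) (A A' : E → E) (t : ℝ) (w : E) :
    flatPerturbation κ w₀ A A' t w = w + (κ * expNegInvGlue t * t) •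
      (A (t⁻¹ • (w - w₀)) + (κ * expNegInvGlue t) • A' (t⁻¹ • (w - w₀))) := by
  rw [flatPerturbation, smul_add, smul_smul, smul_smul, smul_smul]
  congr 3 <;> ring

theorem flatPerturbation_of_nonpos (κ : ℝ) (w₀ : E) (A A' : E → E) {t : ℝ} (ht : t ≤ 0) (w : E) :
    flatPerturbation κ w₀ A A' t w = w := by
  simp [flatPerturbation, expNegInvGlue.zero_of_nonpos ht]

/-- In each summand one factor `expNegInvGlue t` stays attached to the rescaled field, which is
singular without it; the other coefficients are smooth by themselves. -/
theorem contDiff_flatPerturbation (κ : ℝ) (w₀ : E) {A A' : E → E} (hA : ContDiff ℝ ∞ A)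
    (hA' : ContDiff ℝ ∞ A') (hc : HasCompactSupport A) (hc' : HasCompactSupport A') :
    ContDiff ℝ ∞ fun q : ℝ × E => flatPerturbation κ w₀ A A' q.1 q.2 := by
  have hg : ContDiff ℝ ∞ fun q : ℝ × E => expNegInvGlue q.1 :=
    expNegInvGlue.contDiff.comp contDiff_fst
  have hs : ContDiff ℝ ∞ fun q : ℝ × E => (q.1, q.2 - w₀) :=
    contDiff_fst.prodMk (contDiff_snd.sub contDiff_const)
  have h1 := (contDiff_expNegInvGlue_smul_rescale hA hc).comp hs
  have h2 := (contDiff_expNegInvGlue_smul_rescale hA' hc').comp hs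
  have hk : ContDiff ℝ ∞ fun q : ℝ × E => κ * q.1 := contDiff_const.mul contDiff_fst
  exact contDiff_snd.add ((hk.smul h1).add ((hk.mul (contDiff_const.mul hg)).smul h2))

theorem flatPerturbation_of_notMem (κ : ℝ) (w₀ : E) {A A' : E → E} (hA : ∀ z, 1 ≤ ‖z‖ → A z = 0)
    (hA' : ∀ z, 1 ≤ ‖z‖ → A' z = 0) {t : ℝ} {w : E} (hw : w ∉ Metric.closedBall w₀ t) :
    flatPerturbation κ w₀ A A' t w = w := by
  rcases le_or_gt t 0 with ht | ht
  · exact flatPerturbation_of_nonpos κ w₀ A A' ht w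
  · have hz : 1 ≤ ‖t⁻¹ • (w - w₀)‖ := by
      rw [Metric.mem_closedBall, not_le, dist_eq_norm] at hw
      rw [norm_smul, norm_inv, Real.norm_of_nonneg ht.le, inv_mul_eq_div, le_div_iff₀ ht, one_mul]
      exact hw.le
    simp [flatPerturbation, hA _ hz, hA' _ hz]

/-- The rescaling costs a factor $1/t$, which the prefactor $t$ cancels. Hence `κ` can be chosen
before the scale. -/
theorem lipschitzWith_flatPerturbation_sub {κ : ℝ} (hκ0 : 0 ≤ κ) (hκ1 : κ ≤ 1) (w₀ : E)
    {A A' : E → E} {L L' η : ℝ≥0} (hA : LipschitzWith L A) (hA' : LipschitzWith L' A')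
    (hη : κ * (L + L') ≤ η) (t : ℝ) :
    LipschitzWith η fun w => flatPerturbation κ w₀ A A' t w - w := by
  refine LipschitzWith.of_dist_le_mul fun w w' => ?_
  rcases le_or_gt t 0 with ht | ht
  · simp only [flatPerturbation_of_nonpos κ w₀ A A' ht, sub_self, dist_self]
    positivity
  have hg0 := expNegInvGlue.nonneg t
  have hg1 := expNegInvGlue_le_one t
  set g := expNegInvGlue t
  have hz : dist (t⁻¹ • (w - w₀)) (t⁻¹ • (w' - w₀)) = t⁻¹ * dist w w' := by
    rw [dist_smul₀, Real.norm_of_nonneg (by positivity), dist_sub_right]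
  have h1 := hA.dist_le_mul (t⁻¹ • (w - w₀)) (t⁻¹ • (w' - w₀))
  have h2 := hA'.dist_le_mul (t⁻¹ • (w - w₀)) (t⁻¹ • (w' - w₀))
  rw [hz] at h1 h2
  simp only [flatPerturbation_eq, add_sub_cancel_left]
  have hkg : κ * g ≤ κ := mul_le_of_le_one_right hκ0 hg1
  have hkg1 : κ * g ≤ 1 := hkg.trans hκ1
  calc dist _ _ = κ * g * t * dist (A (t⁻¹ • (w - w₀)) + (κ * g) • A' (t⁻¹ • (w - w₀)))
        (A (t⁻¹ • (w' - w₀)) + (κ * g) • A' (t⁻¹ • (w' - w₀))) := by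
        rw [dist_smul₀, Real.norm_of_nonneg (by positivity)]
    _ ≤ κ * g * t * (L * (t⁻¹ * dist w w') + 1 * (L' * (t⁻¹ * dist w w'))) := by
        refine mul_le_mul_of_nonneg_left ((dist_add_add_le _ _ _ _).trans (add_le_add h1 ?_))
          (by positivity)
        rw [dist_smul₀, Real.norm_of_nonneg (by positivity)]
        exact mul_le_mul hkg1 h2 dist_nonneg zero_le_one
    _ = κ * g * ((L + L') * dist w w') := by
        field_simp
    _ ≤ κ * ((L + L') * dist w w') := by gcongr
    _ = κ * (L + L') * dist w w' := by ring
    _ ≤ η * dist w w' := by gcongr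

end FlatPerturbation

/-! ### The vector fields and the resulting local maps. -/

section Fields

variable {c : ℕ}

/-- The unit vector of the first coordinate. -/
def firstVec (hc : 1 ≤ c) : EuclideanSpace ℝ (Fin c) := EuclideanSpace.single ⟨0, hc⟩ 1

theorem norm_firstVec (hc : 1 ≤ c) : ‖firstVec hc‖ = 1 := by simp [firstVec]

theorem firstVec_zero (hc : 1 ≤ c) : firstVec hc ⟨0, hc⟩ = 1 := by simp [firstVec]

theorem abs_smul_firstVec_le (hc : 1 ≤ c) (r : ℝ) (a : Fin c) : |(r • firstVec hc) a| ≤ |r| := by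
  by_cases h : a = ⟨0, hc⟩
  · simp [firstVec, h]
  · simp [firstVec, h]

/-- The vector with entries `±1` given by `b`. -/
def signVec (b : Fin c → Bool) : EuclideanSpace ℝ (Fin c) := WithLp.toLp 2 fun a => boolSign (b a)

/-- The linear vector field contracting the directions of `S` and expanding the others. -/
def saddle (S : Finset (Fin c)) : EuclideanSpace ℝ (Fin c) →L[ℝ] EuclideanSpace ℝ (Fin c) :=
  diagMap fun a => if a ∈ S then -1 else 1

/-- A cutoff function, equal to one on the ball of radius `1 / 2`. -/
def cutoff (c : ℕ) : ContDiffBump (0 : EuclideanSpace ℝ (Fin c)) :=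
  ⟨1 / 2, 1, by norm_num, by norm_num⟩

/-- A cutoff function, equal to one on the ball with center `q` and radius `1 / 16`. -/
def localCutoff (q : EuclideanSpace ℝ (Fin c)) : ContDiffBump q :=
  ⟨1 / 16, 1 / 8, by norm_num, by norm_num⟩

/-- A vector field with two saddles, at `0` and at `firstVec hc / 4`. -/
def twoSaddles (hc : 1 ≤ c) (S₁ S₂ : Finset (Fin c)) (z : EuclideanSpace ℝ (Fin c)) :
    EuclideanSpace ℝ (Fin c) :=
  localCutoff 0 z • saddle S₁ (z - 0)
    + localCutoff ((1 / 4 : ℝ) • firstVec hc) z • saddle S₂ (z - (1 / 4 : ℝ) • firstVec hc)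

/-- The main part of the perturbing fields: two saddles, or a translation. -/
def mainField (hc : 1 ≤ c) (S₁ S₂ : Finset (Fin c)) :
    (Fin c → Bool) ⊕ Bool → EuclideanSpace ℝ (Fin c) → EuclideanSpace ℝ (Fin c)
  | .inl _, z => twoSaddles hc S₁ S₂ z
  | .inr s, z => (boolSign s * cutoff c z) • firstVec hc

/-- The part of the perturbing fields that distinguishes the maps with saddles. -/
def offsetField : (Fin c → Bool) ⊕ Bool → EuclideanSpace ℝ (Fin c) → EuclideanSpace ℝ (Fin c)
  | .inl b, z => (6 / 16 * cutoff c z) • signVec b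
  | .inr _, _ => 0

theorem cutoff_eq_zero {z : EuclideanSpace ℝ (Fin c)} (hz : 1 ≤ ‖z‖) : cutoff c z = 0 :=
  (cutoff c).zero_of_le_dist (by simpa [cutoff] using hz)

theorem cutoff_eq_one {z : EuclideanSpace ℝ (Fin c)} (hz : ‖z‖ ≤ 1 / 2) : cutoff c z = 1 :=
  (cutoff c).one_of_mem_closedBall (by simpa [cutoff] using hz)

theorem localCutoff_eq_zero {q z : EuclideanSpace ℝ (Fin c)} (hz : 1 / 8 ≤ ‖z - q‖) :
    localCutoff q z = 0 :=
  (localCutoff q).zero_of_le_dist (by simpa [localCutoff, dist_eq_norm] using hz)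

theorem localCutoff_eq_one {q z : EuclideanSpace ℝ (Fin c)} (hz : ‖z - q‖ ≤ 1 / 16) :
    localCutoff q z = 1 :=
  (localCutoff q).one_of_mem_closedBall (by simpa [localCutoff, dist_eq_norm] using hz)

theorem norm_quarter_firstVec (hc : 1 ≤ c) : ‖(1 / 4 : ℝ) • firstVec hc‖ = 1 / 4 := by
  rw [norm_smul, norm_firstVec, mul_one, Real.norm_of_nonneg (by norm_num)]

theorem twoSaddles_near_zero (hc : 1 ≤ c) (S₁ S₂ : Finset (Fin c)) {z : EuclideanSpace ℝ (Fin c)}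
    (hz : ‖z - 0‖ ≤ 1 / 16) : twoSaddles hc S₁ S₂ z = saddle S₁ (z - 0) := by
  have h : 1 / 8 ≤ ‖z - (1 / 4 : ℝ) • firstVec hc‖ := by
    have h1 := norm_sub_norm_le ((1 / 4 : ℝ) • firstVec hc) z
    rw [norm_quarter_firstVec, norm_sub_rev] at h1
    rw [sub_zero] at hz
    linarith
  rw [twoSaddles, localCutoff_eq_one hz, localCutoff_eq_zero h, one_smul, zero_smul, add_zero]

theorem twoSaddles_near_quarter (hc : 1 ≤ c) (S₁ S₂ : Finset (Fin c))
    {z : EuclideanSpace ℝ (Fin c)} (hz : ‖z - (1 / 4 : ℝ) • firstVec hc‖ ≤ 1 / 16) :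
    twoSaddles hc S₁ S₂ z = saddle S₂ (z - (1 / 4 : ℝ) • firstVec hc) := by
  have h : 1 / 8 ≤ ‖z - 0‖ := by
    have h1 := norm_sub_norm_le ((1 / 4 : ℝ) • firstVec hc) z
    rw [norm_quarter_firstVec, norm_sub_rev] at h1
    rw [sub_zero]
    linarith
  rw [twoSaddles, localCutoff_eq_one hz, localCutoff_eq_zero h, one_smul, zero_smul, zero_add]

theorem mainField_eq_zero (hc : 1 ≤ c) (S₁ S₂ : Finset (Fin c)) (l : (Fin c → Bool) ⊕ Bool)
    (z : EuclideanSpace ℝ (Fin c)) (hz : 1 ≤ ‖z‖) : mainField hc S₁ S₂ l z = 0 := by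
  cases l with
  | inl b =>
    have h1 : 1 / 8 ≤ ‖z - 0‖ := by rw [sub_zero]; linarith
    have h2 : 1 / 8 ≤ ‖z - (1 / 4 : ℝ) • firstVec hc‖ := by
      have h1 := norm_sub_norm_le z ((1 / 4 : ℝ) • firstVec hc)
      rw [norm_quarter_firstVec] at h1
      linarith
    simp [mainField, twoSaddles, localCutoff_eq_zero h1, localCutoff_eq_zero h2]
  | inr s => simp [mainField, cutoff_eq_zero hz]

theorem offsetField_eq_zero (l : (Fin c → Bool) ⊕ Bool) (z : EuclideanSpace ℝ (Fin c))
    (hz : 1 ≤ ‖z‖) : offsetField l z = 0 := by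
  cases l with
  | inl b => simp [offsetField, cutoff_eq_zero hz]
  | inr s => rfl

theorem hasCompactSupport_of_eq_zero {A : EuclideanSpace ℝ (Fin c) → EuclideanSpace ℝ (Fin c)}
    (hA : ∀ z, 1 ≤ ‖z‖ → A z = 0) : HasCompactSupport A :=
  HasCompactSupport.intro (isCompact_closedBall 0 1) fun z hz =>
    hA z (by simpa using (not_le.1 (fun h => hz (mem_closedBall_zero_iff.2 h))).le)

theorem contDiff_mainField (hc : 1 ≤ c) (S₁ S₂ : Finset (Fin c)) (l : (Fin c → Bool) ⊕ Bool) :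
    ContDiff ℝ ∞ (mainField hc S₁ S₂ l) := by
  cases l with
  | inl b =>
    exact ((localCutoff 0).contDiff.smul ((saddle S₁).contDiff.comp
      (contDiff_id.sub contDiff_const))).add ((localCutoff _).contDiff.smul
      ((saddle S₂).contDiff.comp (contDiff_id.sub contDiff_const)))
  | inr s => exact (contDiff_const.mul (cutoff c).contDiff).smul contDiff_const

theorem contDiff_offsetField (l : (Fin c → Bool) ⊕ Bool) :
    ContDiff ℝ ∞ (offsetField l) := by
  cases l with
  | inl b => exact (contDiff_const.mul (cutoff c).contDiff).smul contDiff_const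
  | inr s => exact contDiff_const

theorem exists_lipschitzWith_fields (hc : 1 ≤ c) (S₁ S₂ : Finset (Fin c)) :
    ∃ L L' : ℝ≥0, ∀ l, LipschitzWith L (mainField hc S₁ S₂ l) ∧
      LipschitzWith L' (offsetField (c := c) l) := by
  choose L hL using fun l => (contDiff_mainField hc S₁ S₂ l).lipschitzWith_of_hasCompactSupport
    (hasCompactSupport_of_eq_zero (mainField_eq_zero hc S₁ S₂ l)) (by simp)
  choose L' hL' using fun l => (contDiff_offsetField (c := c) l).lipschitzWith_of_hasCompactSupport
    (hasCompactSupport_of_eq_zero (offsetField_eq_zero l)) (by simp)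
  exact ⟨∑ l, L l, ∑ l, L' l, fun l =>
    ⟨(hL l).weaken (Finset.single_le_sum (f := L) (fun _ _ => zero_le) (Finset.mem_univ l)),
      (hL' l).weaken (Finset.single_le_sum (f := L') (fun _ _ => zero_le) (Finset.mem_univ l))⟩⟩

/-- The maps of the construction, in the chart, at scale `t`. -/
def localMap (hc : 1 ≤ c) (S₁ S₂ : Finset (Fin c)) (κ : ℝ) (w₀ : EuclideanSpace ℝ (Fin c))
    (l : (Fin c → Bool) ⊕ Bool) (t : ℝ) : EuclideanSpace ℝ (Fin c) → EuclideanSpace ℝ (Fin c) :=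
  flatPerturbation κ w₀ (mainField hc S₁ S₂ l) (offsetField l) t

theorem norm_rescale_sub_le {w w₀ q : EuclideanSpace ℝ (Fin c)} {t r : ℝ} (ht : 0 < t)
    (hw : w ∈ Metric.closedBall (w₀ + t • q) (t * r)) : ‖t⁻¹ • (w - w₀) - q‖ ≤ r := by
  have h : t⁻¹ • (w - w₀) - q = t⁻¹ • (w - (w₀ + t • q)) := by
    rw [← sub_sub, smul_sub t⁻¹ (w - w₀), smul_smul, inv_mul_cancel₀ ht.ne', one_smul]
  rw [mem_closedBall_iff_norm] at hw
  rw [h, norm_smul, norm_inv, Real.norm_of_nonneg ht.le, inv_mul_le_iff₀ ht]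
  exact hw

/-- With $u=\delta t/16$ the step is $\delta t=16u$: more than the side $14u$ of the larger cube,
and less than four times the half side $5u$ of the smaller one, which the transitions need. -/
theorem localMap_inr (hc : 1 ≤ c) (S₁ S₂ : Finset (Fin c)) (κ : ℝ)
    {w₀ w : EuclideanSpace ℝ (Fin c)} (s : Bool) {t : ℝ} (ht : 0 < t)
    (hw : w ∈ Metric.closedBall w₀ (t * (1 / 2))) :
    localMap hc S₁ S₂ κ w₀ (.inr s) t w
      = w + (boolSign s * (κ * expNegInvGlue t * t)) • firstVec hc := by
  have hz : ‖t⁻¹ • (w - w₀)‖ ≤ 1 / 2 := by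
    have := norm_rescale_sub_le (q := 0) ht (by simpa using hw)
    simpa using this
  rw [localMap, flatPerturbation_eq]
  simp only [mainField, offsetField, cutoff_eq_one hz, smul_zero, add_zero, mul_one, smul_smul]
  rw [mul_comm (boolSign s)]

/-- With $p=w_0+tq$ one has $w+\delta t\left(\mp(w-p)/t+\tfrac{6}{16}\delta
b\right)=p+(1\mp\delta)(w-p)+\delta\cdot6u\,b$ for $u=\delta t/16$. The extra $\delta$ on the offset
makes the cubes small compared with the region where the saddle is linear. -/
theorem localMap_inl (hc : 1 ≤ c) (S₁ S₂ : Finset (Fin c)) (κ : ℝ)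
    {w₀ w q : EuclideanSpace ℝ (Fin c)} {S : Finset (Fin c)} (hq : ‖q‖ ≤ 1 / 4)
    (hS : ∀ z, ‖z - q‖ ≤ 1 / 16 → twoSaddles hc S₁ S₂ z = saddle S (z - q))
    (b : Fin c → Bool) {t : ℝ} (ht : 0 < t)
    (hw : w ∈ Metric.closedBall (w₀ + t • q) (t * (1 / 16))) :
    localMap hc S₁ S₂ κ w₀ (.inl b) t w
      = blenderMap S (κ * expNegInvGlue t) (κ * expNegInvGlue t * t / 16) (w₀ + t • q) b w := by
  have hz := norm_rescale_sub_le ht hw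
  have hz' : ‖t⁻¹ • (w - w₀)‖ ≤ 1 / 2 := by
    have := norm_sub_norm_le (t⁻¹ • (w - w₀)) q
    linarith
  rw [localMap, flatPerturbation_eq]
  simp only [mainField, offsetField, cutoff_eq_one hz', hS _ hz]
  ext a
  simp only [saddle, signVec, stretch, blenderMap_apply, diagMap_apply, PiLp.add_apply,
    PiLp.smul_apply, PiLp.sub_apply, smul_eq_mul, mul_one]
  split_ifs
  · field_simp
    ring
  · field_simp
    ring

end Fields

/-! ### Powers in the semigroup and rounding. -/

section Transitions

theorem pow_mem_generatedSemigroup {ι M : Type*} (φ : ι → Equiv.Perm M) (i : ι) {n : ℕ}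
    (hn : 1 ≤ n) : φ i ^ n ∈ generatedSemigroup φ := by
  induction n, hn using Nat.le_induction with
  | base =>
    rw [pow_one]
    exact Subsemigroup.subset_closure (mem_range_self i)
  | succ n _ ih =>
    rw [pow_succ]
    exact mul_mem ih (Subsemigroup.subset_closure (mem_range_self i))

/-- Every positive multiple of a small step comes close to a given distance. -/
theorem exists_nat_mul_near {X L : ℝ} (hL : 0 < L) (hX : L ≤ X) :
    ∃ N : ℕ, 1 ≤ N ∧ |N * L - X| ≤ L / 2 := by
  have h0 : 0 ≤ X / L + 1 / 2 := by
    have := div_nonneg (hL.le.trans hX) hL.le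
    linarith
  have h1 := Nat.floor_le h0
  have h2 := Nat.lt_floor_add_one (X / L + 1 / 2)
  refine ⟨⌊X / L + 1 / 2⌋₊, ?_, ?_⟩
  · rw [Nat.one_le_floor_iff]
    have : 1 ≤ X / L := (one_le_div hL).2 hX
    linarith
  · have h3 : X / L * L = X := div_mul_cancel₀ X hL.ne'
    rw [abs_le]
    constructor
    · nlinarith
    · nlinarith

end Transitions

/-! ### The local model: two blenders joined by translations. -/

section Construction

variable {c : ℕ} {M : Type u} [EMetricSpace M] [ChartedSpace (EuclideanSpace ℝ (Fin c)) M]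

/-- The members of `φ` act in the chart at `x` by the local maps at scale `t`. -/
structure IsLocalModel {ι : Type*} (hc : 1 ≤ c) (S₁ S₂ : Finset (Fin c)) (κ : ℝ) (x : M)
    (lab : ι ≃ (Fin c → Bool) ⊕ Bool) (t : ℝ) (φ : ι → Equiv.Perm M) : Prop where
  amp_pos : 0 < κ
  amp_le : κ ≤ 1 / (16 * c)
  scale_pos : 0 < t
  ball_subset : Metric.closedBall (extChartAt (𝓡 c) x x) t ⊆ (extChartAt (𝓡 c) x).target
  mapsTo : ∀ l, MapsTo (localMap hc S₁ S₂ κ (extChartAt (𝓡 c) x x) l t)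
    (extChartAt (𝓡 c) x).target (extChartAt (𝓡 c) x).target
  apply_symm : ∀ i, ∀ w ∈ (extChartAt (𝓡 c) x).target, φ i ((extChartAt (𝓡 c) x).symm w)
    = (extChartAt (𝓡 c) x).symm (localMap hc S₁ S₂ κ (extChartAt (𝓡 c) x x) (lab i) t w)

namespace IsLocalModel

variable {ι : Type*} {hc : 1 ≤ c} {S₁ S₂ : Finset (Fin c)} {κ : ℝ} {x : M}
  {lab : ι ≃ (Fin c → Bool) ⊕ Bool} {t : ℝ} {φ : ι → Equiv.Perm M}

theorem rate_bounds (H : IsLocalModel hc S₁ S₂ κ x lab t φ) :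
    0 < κ * expNegInvGlue t ∧ κ * expNegInvGlue t ≤ 1 / 16 ∧
      c * (κ * expNegInvGlue t) ≤ 1 / 16 := by
  have hg := expNegInvGlue.pos_of_pos H.scale_pos
  have hg1 := expNegInvGlue_le_one t
  have hc' : (1 : ℝ) ≤ c := by exact_mod_cast hc
  have h1 : κ * expNegInvGlue t ≤ κ := mul_le_of_le_one_right H.amp_pos.le hg1
  have h2 : c * κ ≤ 1 / 16 := by
    have := mul_le_mul_of_nonneg_left H.amp_le (by linarith : (0 : ℝ) ≤ c)
    refine this.trans_eq ?_
    field_simp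
  have h3 : c * (κ * expNegInvGlue t) ≤ c * κ := mul_le_mul_of_nonneg_left h1 (by linarith)
  refine ⟨mul_pos H.amp_pos hg, ?_, h3.trans h2⟩
  have := le_mul_of_one_le_left H.amp_pos.le hc'
  linarith

/-- The Euclidean radius of the cube is at most $7cu=7c\delta t/16$, so $c\delta\le1/16$ suffices;
this is the reason for the bound $\kappa\le1/(16c)$. -/
theorem closedCube_subset_ball (H : IsLocalModel hc S₁ S₂ κ x lab t φ)
    (p : EuclideanSpace ℝ (Fin c)) :
    closedCube p (7 * (κ * expNegInvGlue t * t / 16)) ⊆ Metric.ball p (t * (1 / 16)) := by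
  obtain ⟨h0, h1, h2⟩ := H.rate_bounds
  have ht := H.scale_pos
  refine (_root_.closedCube_subset_closedBall p (by positivity)).trans
    (Metric.closedBall_subset_ball ?_)
  nlinarith [mul_le_mul_of_nonneg_right h2 ht.le]

theorem isAffineBlender (H : IsLocalModel hc S₁ S₂ κ x lab t φ) {q : EuclideanSpace ℝ (Fin c)}
    {S : Finset (Fin c)} (hq : ‖q‖ ≤ 1 / 4)
    (hS : ∀ z, ‖z - q‖ ≤ 1 / 16 → twoSaddles hc S₁ S₂ z = saddle S (z - q)) :
    IsAffineBlender x φ (fun b => lab.symm (.inl b)) S (κ * expNegInvGlue t)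
      (κ * expNegInvGlue t * t / 16) (extChartAt (𝓡 c) x x + t • q)
      (Metric.ball (extChartAt (𝓡 c) x x + t • q) (t * (1 / 16))) := by
  obtain ⟨h0, h1, h2⟩ := H.rate_bounds
  have ht := H.scale_pos
  set w₀ := extChartAt (𝓡 c) x x
  have hb : Metric.ball (w₀ + t • q) (t * (1 / 16)) ⊆ Metric.closedBall w₀ (t * (1 / 2)) := by
    intro w hw
    rw [mem_ball_iff_norm] at hw
    rw [mem_closedBall_iff_norm]
    have h3 : ‖w - w₀‖ ≤ ‖w - (w₀ + t • q)‖ + ‖t • q‖ := by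
      have : w - w₀ = (w - (w₀ + t • q)) + t • q := by abel
      rw [this]
      exact norm_add_le _ _
    rw [norm_smul, Real.norm_of_nonneg ht.le] at h3
    nlinarith
  have hbT : Metric.ball (w₀ + t • q) (t * (1 / 16)) ⊆ (extChartAt (𝓡 c) x).target :=
    hb.trans ((Metric.closedBall_subset_closedBall (by linarith)).trans H.ball_subset)
  have haff : ∀ b, ∀ w ∈ Metric.ball (w₀ + t • q) (t * (1 / 16)),
      localMap hc S₁ S₂ κ w₀ (.inl b) t w
        = blenderMap S (κ * expNegInvGlue t) (κ * expNegInvGlue t * t / 16) (w₀ + t • q) b w :=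
    fun b w hw => localMap_inl hc S₁ S₂ κ hq hS b ht (Metric.ball_subset_closedBall hw)
  refine ⟨h0, by linarith, by positivity, Metric.isOpen_ball, hbT, H.closedCube_subset_ball _,
    fun b w hw => ?_, fun b w hw => ?_, fun i hi w hw => ?_⟩
  · rw [← haff b w hw]
    exact H.mapsTo _ (hbT hw)
  · rw [H.apply_symm _ w (hbT hw), Equiv.apply_symm_apply, haff b w hw]
  · obtain ⟨s, hs⟩ : ∃ s, lab i = .inr s := by
      rcases hl : lab i with b | s
      · exact absurd ⟨b, lab.symm_apply_eq.2 hl.symm⟩ hi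
      · exact ⟨s, rfl⟩
    have hwb := H.closedCube_subset_ball _ hw
    rintro ⟨w', hw', he⟩
    rw [H.apply_symm _ w (hbT hwb)] at he
    have he' := (extChartAt (𝓡 c) x).symm.injOn (hbT (H.closedCube_subset_ball _ hw'))
      (H.mapsTo _ (hbT hwb)) he
    rw [hs, localMap_inr hc S₁ S₂ κ s ht (hb hwb)] at he'
    -- Two points of the cube differ by at most $14u$ in the first coordinate, but the translation
    -- changes it by $16u$.
    have h3 := abs_le.1 (hw ⟨0, hc⟩)
    have h4 := abs_le.1 (hw' ⟨0, hc⟩)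
    have h5 : 0 < κ * expNegInvGlue t * t := mul_pos h0 ht
    rw [he'] at h4
    simp only [PiLp.add_apply, PiLp.smul_apply, firstVec_zero, smul_eq_mul, mul_one] at h3 h4
    cases s
    · simp only [boolSign, if_neg Bool.false_ne_true] at h4
      linarith
    · simp only [boolSign, if_true] at h4
      linarith

/-- The cutoff equals one only on the ball of radius $t/2$, so the bound is required along the whole
way. -/
theorem pow_translation (H : IsLocalModel hc S₁ S₂ κ x lab t φ) (s : Bool) {r : ℝ} {N : ℕ}
    (hr : ∀ n ≤ N, |r + boolSign s * (n * (κ * expNegInvGlue t * t))| ≤ t * (1 / 2)) :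
    ∀ n ≤ N, (φ (lab.symm (.inr s)) ^ n)
      ((extChartAt (𝓡 c) x).symm (extChartAt (𝓡 c) x x + r • firstVec hc))
      = (extChartAt (𝓡 c) x).symm (extChartAt (𝓡 c) x x
        + (r + boolSign s * (n * (κ * expNegInvGlue t * t))) • firstVec hc) := by
  intro n
  induction n with
  | zero => intro _; simp
  | succ n ih =>
    intro hn
    rw [pow_succ', Equiv.Perm.mul_apply, ih (by omega)]
    have hw : extChartAt (𝓡 c) x x + (r + boolSign s * (n * (κ * expNegInvGlue t * t))) •
        firstVec hc ∈ Metric.closedBall (extChartAt (𝓡 c) x x) (t * (1 / 2)) := by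
      rw [mem_closedBall_iff_norm, add_sub_cancel_left, norm_smul, norm_firstVec, mul_one]
      exact hr n (by omega)
    rw [H.apply_symm _ _ (H.ball_subset
      (Metric.closedBall_subset_closedBall (by linarith [H.scale_pos]) hw)),
      Equiv.apply_symm_apply, localMap_inr hc S₁ S₂ κ s H.scale_pos hw, add_assoc, ← add_smul]
    congr 3
    push_cast
    ring

/-- The translations give transitions in both directions between the two saddles. -/
theorem hasTransition (H : IsLocalModel hc S₁ S₂ κ x lab t φ) :
    HasTransition φ
      (chartCube x (extChartAt (𝓡 c) x x + t • (0 : EuclideanSpace ℝ (Fin c)))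
        (5 * (κ * expNegInvGlue t * t / 16)))
      (chartCube x (extChartAt (𝓡 c) x x + t • (1 / 4 : ℝ) • firstVec hc)
        (5 * (κ * expNegInvGlue t * t / 16))) ∧
    HasTransition φ
      (chartCube x (extChartAt (𝓡 c) x x + t • (1 / 4 : ℝ) • firstVec hc)
        (5 * (κ * expNegInvGlue t * t / 16)))
      (chartCube x (extChartAt (𝓡 c) x x + t • (0 : EuclideanSpace ℝ (Fin c)))
        (5 * (κ * expNegInvGlue t * t / 16))) := by
  obtain ⟨h0, h1, -⟩ := H.rate_bounds
  have ht := H.scale_pos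
  set L := κ * expNegInvGlue t * t with hL
  have hL0 : 0 < L := mul_pos h0 ht
  have hLt : L ≤ t * (1 / 16) := by nlinarith
  obtain ⟨N, hN1, hN⟩ := exists_nat_mul_near (X := t * (1 / 4)) hL0 (by linarith)
  -- The rounding error, at most $L/2=8u$. Starting at $-d/2$ and arriving at $t/4+d/2$ leaves an
  -- offset of at most $4u<5u$ at either end; the return path is the same one reversed.
  set d := N * L - t * (1 / 4) with hd
  have hd' := abs_le.1 hN
  have hcube : ∀ r r' : ℝ, |r - r'| < 5 * (L / 16) →
      extChartAt (𝓡 c) x x + r • firstVec hc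
        ∈ openCube (extChartAt (𝓡 c) x x + r' • firstVec hc) (5 * (L / 16)) := by
    intro r r' hr a
    have h3 : (extChartAt (𝓡 c) x x + r • firstVec hc) a
        - (extChartAt (𝓡 c) x x + r' • firstVec hc) a = ((r - r') • firstVec hc) a := by
      simp [sub_mul]
    rw [h3]
    exact (abs_smul_firstVec_le hc _ a).trans_lt hr
  have hp1 : extChartAt (𝓡 c) x x + t • (0 : EuclideanSpace ℝ (Fin c))
      = extChartAt (𝓡 c) x x + (0 : ℝ) • firstVec hc := by simp
  have hp2 : extChartAt (𝓡 c) x x + t • (1 / 4 : ℝ) • firstVec hc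
      = extChartAt (𝓡 c) x x + (t * (1 / 4)) • firstVec hc := by rw [smul_smul]
  rw [hp1, hp2]
  have hA : extChartAt (𝓡 c) x x + (-(d / 2)) • firstVec hc
      ∈ openCube (extChartAt (𝓡 c) x x + (0 : ℝ) • firstVec hc) (5 * (L / 16)) :=
    hcube _ _ (by rw [abs_lt]; constructor <;> linarith)
  have hB : extChartAt (𝓡 c) x x + (t * (1 / 4) + d / 2) • firstVec hc
      ∈ openCube (extChartAt (𝓡 c) x x + (t * (1 / 4)) • firstVec hc) (5 * (L / 16)) :=
    hcube _ _ (by rw [abs_lt]; constructor <;> linarith)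
  have hn0 : ∀ n : ℕ, n ≤ N → 0 ≤ n * L ∧ n * L ≤ N * L := fun n hn =>
    ⟨by positivity, mul_le_mul_of_nonneg_right (by exact_mod_cast hn) hL0.le⟩
  constructor
  · refine ⟨_, mem_image_of_mem _ hA, _, pow_mem_generatedSemigroup φ (lab.symm (.inr true)) hN1,
      ?_⟩
    rw [H.pow_translation true (N := N) (fun n hn => ?_) N le_rfl]
    · have h3 : -(d / 2) + boolSign true * (N * (κ * expNegInvGlue t * t))
          = t * (1 / 4) + d / 2 := by
        simp only [boolSign, if_true, ← hL]
        linarith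
      rw [h3]
      exact mem_image_of_mem _ hB
    · simp only [boolSign, if_true, ← hL, one_mul]
      have := hn0 n hn
      rw [abs_le]
      constructor <;> linarith
  · refine ⟨_, mem_image_of_mem _ hB, _, pow_mem_generatedSemigroup φ (lab.symm (.inr false)) hN1,
      ?_⟩
    rw [H.pow_translation false (N := N) (fun n hn => ?_) N le_rfl]
    · have h3 : t * (1 / 4) + d / 2 + boolSign false * (N * (κ * expNegInvGlue t * t))
          = -(d / 2) := by
        simp only [boolSign, if_neg Bool.false_ne_true, ← hL]
        linarith
      rw [h3]
      exact mem_image_of_mem _ hA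
    · simp only [boolSign, if_neg Bool.false_ne_true, ← hL]
      have := hn0 n hn
      rw [abs_le]
      constructor <;> linarith

theorem closedCube_subset_closedBall (H : IsLocalModel hc S₁ S₂ κ x lab t φ)
    {q : EuclideanSpace ℝ (Fin c)} (hq : ‖q‖ ≤ 1 / 4) :
    closedCube (extChartAt (𝓡 c) x x + t • q) (7 * (κ * expNegInvGlue t * t / 16))
      ⊆ Metric.closedBall (extChartAt (𝓡 c) x x) t := by
  refine (H.closedCube_subset_ball _).trans fun w hw => ?_
  have ht := H.scale_pos
  rw [mem_ball_iff_norm] at hw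
  rw [mem_closedBall_iff_norm]
  have h3 : ‖w - extChartAt (𝓡 c) x x‖
      ≤ ‖w - (extChartAt (𝓡 c) x x + t • q)‖ + ‖t • q‖ := by
    have : w - extChartAt (𝓡 c) x x = (w - (extChartAt (𝓡 c) x x + t • q)) + t • q := by abel
    rw [this]
    exact norm_add_le _ _
  rw [norm_smul, Real.norm_of_nonneg ht.le] at h3
  nlinarith

theorem chartCube_subset (H : IsLocalModel hc S₁ S₂ κ x lab t φ) {q : EuclideanSpace ℝ (Fin c)}
    (hq : ‖q‖ ≤ 1 / 4) :
    chartCube x (extChartAt (𝓡 c) x x + t • q) (7 * (κ * expNegInvGlue t * t / 16))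
      ⊆ (extChartAt (𝓡 c) x).symm '' Metric.closedBall (extChartAt (𝓡 c) x x) t :=
  image_mono ((openCube_subset_closedCube _ _).trans (H.closedCube_subset_closedBall hq))

theorem disjoint_chartCube (H : IsLocalModel hc S₁ S₂ κ x lab t φ) :
    Disjoint
      (chartCube x (extChartAt (𝓡 c) x x + t • (0 : EuclideanSpace ℝ (Fin c)))
        (7 * (κ * expNegInvGlue t * t / 16)))
      (chartCube x (extChartAt (𝓡 c) x x + t • (1 / 4 : ℝ) • firstVec hc)
        (7 * (κ * expNegInvGlue t * t / 16))) := by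
  obtain ⟨h0, h1, -⟩ := H.rate_bounds
  have ht := H.scale_pos
  have hB1 := H.isAffineBlender (S := S₁) (q := 0) (by simp) fun z => twoSaddles_near_zero hc S₁ S₂
  have hB2 := H.isAffineBlender (S := S₂) (norm_quarter_firstVec hc).le
    fun z => twoSaddles_near_quarter hc S₁ S₂
  rw [Set.disjoint_left]
  rintro _ ⟨w, hw, rfl⟩ ⟨w', hw', he⟩
  have he' := (extChartAt (𝓡 c) x).symm.injOn
    (hB2.cube_subset_target le_rfl (openCube_subset_closedCube _ _ hw'))
    (hB1.cube_subset_target le_rfl (openCube_subset_closedCube _ _ hw)) he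
  subst he'
  have h3 := abs_lt.1 (hw ⟨0, hc⟩)
  have h4 := abs_lt.1 (hw' ⟨0, hc⟩)
  simp only [PiLp.add_apply, PiLp.smul_apply, firstVec_zero, smul_eq_mul, mul_one,
    PiLp.zero_apply, mul_zero, add_zero] at h3 h4
  nlinarith

end IsLocalModel

end Construction

/-! ### Uniform control on a small chart ball. -/

section LocalGeometry

variable {c : ℕ} {M : Type u} [EMetricSpace M] [ChartedSpace (EuclideanSpace ℝ (Fin c)) M]
  [IsManifold (𝓡 c) ∞ M] [Bundle.RiemannianBundle (fun x : M => TangentSpace (𝓡 c) x)]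
  [IsContinuousRiemannianBundle (EuclideanSpace ℝ (Fin c)) (fun x : M => TangentSpace (𝓡 c) x)]
  [IsRiemannianManifold (𝓡 c) M]

theorem exists_chart_radius (x : M) {U : Set M} (hU : U ∈ 𝓝 x) :
    ∃ R > (0 : ℝ), ∃ (C : ℝ) (C' : ℝ≥0), 0 < C' ∧
      ∀ w ∈ Metric.closedBall (extChartAt (𝓡 c) x x) R,
        ((extChartAt (𝓡 c) x).symm w ∈ U ∧
          edist ((extChartAt (𝓡 c) x).symm w) x ≤ C' * edist w (extChartAt (𝓡 c) x x)) ∧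
        ‖chartDeriv c x ((extChartAt (𝓡 c) x).symm w)‖ ≤ C ∧
          ‖chartSymmDeriv c x ((extChartAt (𝓡 c) x).symm w)‖ ≤ C := by
  obtain ⟨C, -, hC⟩ := eventually_norm_chartDeriv_lt (c := c) x
  obtain ⟨C', hC', hCe⟩ := eventually_riemannianEDist_le_edist_extChartAt (𝓡 c) x
  have hev := (hCe.and hC).and hU
  have hcont : ContinuousAt (extChartAt (𝓡 c) x).symm (extChartAt (𝓡 c) x x) :=
    continuousAt_extChartAt_symm x
  have hev2 : ∀ᶠ w in 𝓝 (extChartAt (𝓡 c) x x), _ :=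
    hcont.eventually (by rw [extChartAt_to_inv]; exact hev)
  obtain ⟨R, hR, hRs⟩ := Metric.nhds_basis_closedBall.mem_iff.1
    (hev2.and (extChartAt_target_mem_nhds x))
  refine ⟨R, hR, C, C', hC', fun w hw => ?_⟩
  obtain ⟨⟨⟨h1, h2⟩, h3⟩, h4⟩ := hRs hw
  refine ⟨⟨h3, ?_⟩, h2.1.le, h2.2.le⟩
  rw [(extChartAt (𝓡 c) x).right_inv h4, ← IsRiemannianManifold.out, edist_comm,
    edist_comm _ w] at h1
  exact h1

end LocalGeometry

/-! ### Choice of the amplitude, and inverses of the local maps. -/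

section Realization

variable {c : ℕ}

theorem exists_amplitude (hc : 1 ≤ c) (S₁ S₂ : Finset (Fin c)) {η : ℝ≥0} (hη : 0 < η) :
    ∃ κ : ℝ, 0 < κ ∧ κ ≤ 1 / (16 * c) ∧ ∀ (w₀ : EuclideanSpace ℝ (Fin c)) l t,
      LipschitzWith η fun w => localMap hc S₁ S₂ κ w₀ l t w - w := by
  obtain ⟨L, L', hL⟩ := exists_lipschitzWith_fields hc S₁ S₂
  have hc' : (1 : ℝ) ≤ c := by exact_mod_cast hc
  have hη' : (0 : ℝ) < η := by exact_mod_cast hη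
  have hs : (0 : ℝ) < L + L' + 1 := by positivity
  refine ⟨min (1 / (16 * c)) (η / (L + L' + 1)), by positivity, min_le_left _ _,
    fun w₀ l t => ?_⟩
  refine lipschitzWith_flatPerturbation_sub (by positivity) ?_ w₀ (hL l).1 (hL l).2 ?_ t
  · refine (min_le_left _ _).trans ?_
    rw [div_le_one (by positivity)]
    linarith
  · calc _ ≤ η / (L + L' + 1) * ((L : ℝ) + L' + 1) := by
          refine mul_le_mul (min_le_right _ _) (by linarith) (by positivity) (by positivity)
      _ = η := div_mul_cancel₀ _ hs.ne'

theorem contDiff_localMap_family (hc : 1 ≤ c) (S₁ S₂ : Finset (Fin c)) (κ : ℝ)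
    (w₀ : EuclideanSpace ℝ (Fin c)) (l : (Fin c → Bool) ⊕ Bool) :
    ContDiff ℝ ∞ fun q : ℝ × EuclideanSpace ℝ (Fin c) =>
      localMap hc S₁ S₂ κ w₀ l q.1 q.2 :=
  contDiff_flatPerturbation κ w₀ (contDiff_mainField hc S₁ S₂ l) (contDiff_offsetField l)
    (hasCompactSupport_of_eq_zero (mainField_eq_zero hc S₁ S₂ l))
    (hasCompactSupport_of_eq_zero (offsetField_eq_zero l))

theorem contDiff_localMap (hc : 1 ≤ c) (S₁ S₂ : Finset (Fin c)) (κ : ℝ)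
    (w₀ : EuclideanSpace ℝ (Fin c)) (l : (Fin c → Bool) ⊕ Bool) (t : ℝ) :
    ContDiff ℝ ∞ (localMap hc S₁ S₂ κ w₀ l t) :=
  (contDiff_localMap_family hc S₁ S₂ κ w₀ l).comp (contDiff_const.prodMk contDiff_id)

/-- The local maps are diffeomorphisms close to the identity, and so are their inverses. -/
theorem exists_inverse_localMap (hc : 1 ≤ c) (S₁ S₂ : Finset (Fin c)) {η : ℝ≥0} (hη : 0 < η) :
    ∃ κ : ℝ, 0 < κ ∧ κ ≤ 1 / (16 * c) ∧ ∀ (w₀ : EuclideanSpace ℝ (Fin c)) l t,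
      ∃ g : EuclideanSpace ℝ (Fin c) → EuclideanSpace ℝ (Fin c), ContDiff ℝ ∞ g ∧
        (∀ w, g (localMap hc S₁ S₂ κ w₀ l t w) = w) ∧
        (∀ w, localMap hc S₁ S₂ κ w₀ l t (g w) = w) ∧
        (∀ R, t ≤ R → SupportedOn (Metric.closedBall w₀ R) (localMap hc S₁ S₂ κ w₀ l t) ∧
          SupportedOn (Metric.closedBall w₀ R) g) ∧
        LipschitzWith η (fun w => localMap hc S₁ S₂ κ w₀ l t w - w) ∧
        LipschitzWith η (fun w => g w - w) := by
  have h1η : 0 < 1 + η := by positivity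
  have hη1 : η / (1 + η) < 1 := by
    rw [div_lt_one h1η]
    exact lt_one_add η
  -- The number $\eta'=\eta/(1+\eta)$ solves $\eta'/(1-\eta')=\eta$, so the inverse gets exactly the
  -- constant `η`.
  obtain ⟨κ, hκ0, hκ1, hκ⟩ := exists_amplitude hc S₁ S₂ (div_pos hη h1η)
  refine ⟨κ, hκ0, hκ1, fun w₀ l t => ?_⟩
  have hsm := contDiff_localMap hc S₁ S₂ κ w₀ l t
  obtain ⟨h, hh, hhs, hhL⟩ := exists_homeomorph_of_lipschitzWith_sub_id hsm hη1 (hκ w₀ l t)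
  have hsupp : ∀ R, t ≤ R → ∀ w, w ∉ Metric.closedBall w₀ R →
      localMap hc S₁ S₂ κ w₀ l t w = w := fun R hR w hw =>
    flatPerturbation_of_notMem κ w₀ (mainField_eq_zero hc S₁ S₂ l) (offsetField_eq_zero l)
      fun hw' => hw (Metric.closedBall_subset_closedBall hR hw')
  have hinv : ∀ w, h.symm (localMap hc S₁ S₂ κ w₀ l t w) = w := fun w => by
    rw [← hh, h.symm_apply_apply]
  refine ⟨h.symm, hhs, hinv, fun w => ?_, fun R hR => ⟨?_, ?_⟩, (hκ w₀ l t).weaken ?_,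
    hhL.weaken ?_⟩
  · rw [← hh, h.apply_symm_apply]
  · exact supportedOn_of_injective (Function.LeftInverse.injective hinv) (hsupp R hR)
  · refine supportedOn_of_injective h.symm.injective fun w hw => ?_
    nth_rw 1 [← hsupp R hR w hw]
    exact hinv w
  · exact div_le_self zero_le (by simp)
  · have : 1 - η / (1 + η) = 1 / (1 + η) := by
      rw [tsub_eq_iff_eq_add_of_le hη1.le, ← add_div, div_self h1η.ne']
    rw [this, div_div_div_cancel_right₀ h1η.ne', div_one]

end Realization

/-- For $j>0$ the second saddle may be a source. For $j=0$ both signatures have the same size, which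
must be positive and less than $c$, so $c\ge2$ is needed. -/
theorem exists_signatures {c j : ℕ} (hc : 1 ≤ c) (hj : j ≤ c) (hcj : c = 1 → j = 1) :
    ∃ S₁ S₂ : Finset (Fin c), S₁.card = S₂.card + j ∧ 0 < S₁.card ∧ 0 < (S₂ᶜ).card := by
  rcases Nat.eq_zero_or_pos j with rfl | hj0
  · have hc2 : 2 ≤ c := by
      by_contra h
      have : c = 1 := by omega
      simpa using hcj this
    refine ⟨{⟨0, hc⟩}, {⟨0, hc⟩}, rfl, by simp, ?_⟩
    rw [Finset.card_compl, Fintype.card_fin, Finset.card_singleton]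
    omega
  · obtain ⟨S, -, hS⟩ := Finset.exists_subset_card_eq (s := (Finset.univ : Finset (Fin c)))
      (n := j) (by simpa using hj)
    refine ⟨S, ∅, by simp [hS], by omega, ?_⟩
    rwa [Finset.compl_empty, Finset.card_univ, Fintype.card_fin]

end

/-! ### Assembly. -/

theorem mainTheorem8 (c : ℕ) (hc : 1 ≤ c) :
    -- the number of maps depends only on the dimension
    ∃ k : ℕ,
    ∀ (M : Type u) [EMetricSpace M] [ChartedSpace (EuclideanSpace ℝ (Fin c)) M]
      [IsManifold (𝓡 c) ∞ M]
      [Bundle.RiemannianBundle (fun x : M => TangentSpace (𝓡 c) x)]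
      [IsContinuousRiemannianBundle (EuclideanSpace ℝ (Fin c))
        (fun x : M => TangentSpace (𝓡 c) x)]
      [IsRiemannianManifold (𝓡 c) M]
      (r : ℕ∞) (ν α : ℝ) (_ : 0 < ν) (_ : ν < 1) (_ : 0 < α)
      -- the co-index; the pair `c = 1`, `j = 0` cannot occur
      (j : ℕ) (_ : j ≤ c) (_ : c = 1 → j = 1)
      (x : M) (U : Set M) (_ : U ∈ 𝓝 x),
    ∃ (φ : Fin (k + 1) → ℝ≥0 → M ≃ₘ^(r : WithTop ℕ∞)⟮𝓡 c, 𝓡 c⟯ M)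
      (D₁ D₂ B₁ B₂ : ℝ≥0 → Set M) (s₁ t₁ s₂ t₂ : ℕ),
      (∀ i, IsArc c r (φ i)) ∧
      (∀ i, φ i 0 = Diffeomorph.refl (𝓡 c) M (r : WithTop ℕ∞)) ∧
      (∀ ε : ℝ≥0, IsPHS ν α (fun i => (φ i ε).toEquiv)) ∧
      s₁ = s₂ + j ∧
      ∀ ε : ℝ≥0, 0 < ε →
        D₁ ε ⊆ U ∩ Metric.eball x ε ∧ D₂ ε ⊆ U ∩ Metric.eball x ε ∧
        Disjoint (D₁ ε) (D₂ ε) ∧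
        IsCsBlendingRegion c (fun i => (φ i ε).toEquiv) (B₁ ε) (D₁ ε) s₁ t₁ ∧
        IsCuBlendingRegion c (fun i => (φ i ε).toEquiv) (B₂ ε) (D₂ ε) s₂ t₂ ∧
        HasTransition (fun i => (φ i ε).toEquiv) (B₁ ε) (B₂ ε) ∧
        HasTransition (fun i => (φ i ε).toEquiv) (B₂ ε) (B₁ ε) := by

  classical
  -- The number of maps is $2^c+2$: the saddle maps and the two translations.
  obtain ⟨k, hk⟩ : ∃ k, Fintype.card ((Fin c → Bool) ⊕ Bool) = k + 1 :=
    Nat.exists_eq_succ_of_ne_zero Fintype.card_ne_zero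
  let lab : Fin (k + 1) ≃ (Fin c → Bool) ⊕ Bool := (Fintype.equivFinOfCardEq hk).symm
  refine ⟨k, ?_⟩
  intro M _ _ _ _ _ _ r ν α hν0 hν1 hα j hj hcj x U hU
  obtain ⟨S₁, S₂, hS, hS₁, hS₂⟩ := exists_signatures hc hj hcj
  obtain ⟨γ, hγν, hγ1⟩ : ∃ γ : ℝ≥0, ν ^ α < (γ : ℝ) ∧ γ < 1 := by
    have h1 : ν ^ α < 1 := Real.rpow_lt_one hν0.le hν1 hα
    have h2 : 0 < ν ^ α := Real.rpow_pos_of_pos hν0 α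
    refine ⟨Real.toNNReal ((ν ^ α + 1) / 2), ?_, ?_⟩
    · rw [Real.coe_toNNReal _ (by linarith)]
      linarith
    · rw [Real.toNNReal_lt_one]
      linarith
  have hγ0 : 0 < γ := by
    have h2 : 0 < ν ^ α := Real.rpow_pos_of_pos hν0 α
    exact_mod_cast h2.trans hγν
  obtain ⟨R, hR, hRt, η, hη, hLip⟩ := exists_lipschitzWith_chartConj (c := c) x
    ((one_lt_inv₀ hγ0).2 hγ1)
  obtain ⟨R', hR', C, C', hC', hgeom⟩ := exists_chart_radius (c := c) x hU
  obtain ⟨κ, hκ0, hκ1, hκ⟩ := exists_inverse_localMap hc S₁ S₂ hη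
  set w₀ := extChartAt (𝓡 c) x x with hw₀
  choose g hg hgf hfg hsupp hfL hgL using hκ w₀
  -- The chart inverse is `C'`-Lipschitz toward `x`, so $\varepsilon/(2C')$ keeps the regions in the
  -- ball of radius $\varepsilon$. The cap `R'` keeps them in `U` and the chart constants valid. The
  -- cap `R / 2` leaves an open interval of scales below `R` on which all supports lie in one
  -- compact ball.
  let θ : ℝ≥0 → ℝ := fun ε => min (ε / (2 * C')) (min (R / 2) R')
  have hC'0 : (0 : ℝ) < C' := by exact_mod_cast hC'
  have hθc : Continuous θ := by fun_prop
  have hθR : ∀ ε, θ ε ≤ R / 2 := fun ε => (min_le_right _ _).trans (min_le_left _ _)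
  have hθR' : ∀ ε, θ ε ≤ R' := fun ε => (min_le_right _ _).trans (min_le_right _ _)
  have hθε : ∀ ε, θ ε ≤ ε / (2 * C') := fun ε => min_le_left _ _
  have hθ0 : θ 0 = 0 := by
    simp only [θ, NNReal.coe_zero, zero_div]
    exact min_eq_left (by positivity)
  have hθpos : ∀ ε : ℝ≥0, 0 < ε → 0 < θ ε := fun ε hε => by
    have : (0 : ℝ) < ε := by exact_mod_cast hε
    positivity
  have hθR1 : ∀ ε, θ ε ≤ R := fun ε => (hθR ε).trans (by linarith)
  have hKc : IsCompact (Metric.closedBall w₀ R) := isCompact_closedBall _ _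
  let φ : Fin (k + 1) → ℝ≥0 → M ≃ₘ^(r : WithTop ℕ∞)⟮𝓡 c, 𝓡 c⟯ M := fun i ε =>
    chartDiffeomorph r hRt hKc (contDiff_localMap hc S₁ S₂ κ w₀ (lab i) (θ ε))
      (hg (lab i) (θ ε)) (hsupp (lab i) (θ ε) R (hθR1 ε)).1 (hsupp (lab i) (θ ε) R (hθR1 ε)).2
      (hgf (lab i) (θ ε)) (hfg (lab i) (θ ε))
  have hφ : ∀ i ε y, φ i ε y = chartConj x (localMap hc S₁ S₂ κ w₀ (lab i) (θ ε)) y :=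
    fun _ _ _ => rfl
  have hmodel : ∀ ε, 0 < ε →
      IsLocalModel hc S₁ S₂ κ x lab (θ ε) fun i => (φ i ε).toEquiv := fun ε hε =>
    { amp_pos := hκ0
      amp_le := hκ1
      scale_pos := hθpos ε hε
      ball_subset := (Metric.closedBall_subset_closedBall (hθR1 ε)).trans hRt
      mapsTo := fun l => (hsupp l (θ ε) R (hθR1 ε)).1.mapsTo_of_subset hRt
      apply_symm := fun i w hw => chartConj_symm _ hw }
  have hq1 : ‖(0 : EuclideanSpace ℝ (Fin c))‖ ≤ 1 / 4 := by simp
  have hq2 := (norm_quarter_firstVec hc).le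
  refine ⟨φ, fun ε => chartCube x (w₀ + θ ε • (0 : EuclideanSpace ℝ (Fin c)))
      (7 * (κ * expNegInvGlue (θ ε) * θ ε / 16)),
    fun ε => chartCube x (w₀ + θ ε • (1 / 4 : ℝ) • firstVec hc)
      (7 * (κ * expNegInvGlue (θ ε) * θ ε / 16)),
    fun ε => chartCube x (w₀ + θ ε • (0 : EuclideanSpace ℝ (Fin c)))
      (5 * (κ * expNegInvGlue (θ ε) * θ ε / 16)),
    fun ε => chartCube x (w₀ + θ ε • (1 / 4 : ℝ) • firstVec hc)
      (5 * (κ * expNegInvGlue (θ ε) * θ ε / 16)),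
    S₁.card, (S₁ᶜ).card, S₂.card, (S₂ᶜ).card, fun i => ?_, fun i => ?_, fun ε => ?_, hS,
    fun ε hε => ?_⟩
  · refine isArc_of_contMDiffAt r
      (g := fun t => chartConj x (localMap hc S₁ S₂ κ w₀ (lab i) t)) hθc (hφ i) (fun ε y => ?_)
      (isCompact_extChartAt_symm_image hRt hKc) fun ε y hy =>
      chartConj_of_notMem (hsupp (lab i) (θ ε) R (hθR1 ε)).1 hy
    exact contMDiffAt_chartConj_family hRt hKc
      (contDiff_localMap_family hc S₁ S₂ κ w₀ (lab i)) isOpen_Iio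
      (fun t ht => (hsupp (lab i) t R (le_of_lt ht)).1)
      (lt_of_le_of_lt (hθR ε) (by linarith)) y
  · ext y
    rw [hφ, hθ0]
    have h1 : localMap hc S₁ S₂ κ w₀ (lab i) 0 = fun w => w :=
      funext fun w => flatPerturbation_of_nonpos κ w₀ _ _ le_rfl w
    rw [h1]
    exact chartConj_id x y
  -- The lower bound is the Lipschitz bound for the inverse map, which is as close to the identity
  -- as the map itself.
  · refine ⟨γ, γ, hγν, hγ1, hγν, hγ1, fun i => ⟨?_, ?_⟩⟩
    · exact (hLip _ (hg (lab i) (θ ε)) (hsupp (lab i) (θ ε) R (hθR1 ε)).2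
        (hgL (lab i) (θ ε))).to_rightInverse (φ i ε).left_inv
    · exact hLip _ (contDiff_localMap hc S₁ S₂ κ w₀ (lab i) (θ ε))
        (hsupp (lab i) (θ ε) R (hθR1 ε)).1 (hfL (lab i) (θ ε))
  · have H := hmodel ε hε
    have hsub : (extChartAt (𝓡 c) x).symm '' Metric.closedBall w₀ (θ ε)
        ⊆ U ∩ Metric.eball x ε := by
      rintro _ ⟨w, hw, rfl⟩
      have h1 := (hgeom w (Metric.closedBall_subset_closedBall (hθR' ε) hw)).1
      refine ⟨h1.1, lt_of_le_of_lt h1.2 ?_⟩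
      have h2 : nndist w w₀ ≤ ε / (2 * C') := by
        rw [← NNReal.coe_le_coe]
        exact (Metric.mem_closedBall.1 hw).trans (by simpa using hθε ε)
      rw [edist_nndist, ← ENNReal.coe_mul, ENNReal.coe_lt_coe]
      calc C' * nndist w w₀ ≤ C' * (ε / (2 * C')) := by gcongr
        _ = ε / 2 := by field_simp
        _ < ε := NNReal.half_lt_self hε.ne'
    have hD1 := (H.chartCube_subset hq1).trans hsub
    have hD2 := (H.chartCube_subset hq2).trans hsub
    have hbd : ∀ D : Set M, D ⊆ U ∩ Metric.eball x ε → Metric.ediam D ≠ ⊤ := fun D hD =>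
      ne_top_of_le_ne_top (ENNReal.mul_ne_top (by simp) ENNReal.coe_ne_top)
        ((Metric.ediam_mono (hD.trans inter_subset_right)).trans Metric.ediam_eball_le)
    have hA1 := H.isAffineBlender (S := S₁) hq1 fun z => twoSaddles_near_zero hc S₁ S₂
    have hA2 := H.isAffineBlender (S := S₂) hq2 fun z => twoSaddles_near_quarter hc S₁ S₂
    have hcube : ∀ q : EuclideanSpace ℝ (Fin c), ‖q‖ ≤ 1 / 4 →
        ∀ w ∈ closedCube (w₀ + θ ε • q) (7 * (κ * expNegInvGlue (θ ε) * θ ε / 16)),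
          ‖chartDeriv c x ((extChartAt (𝓡 c) x).symm w)‖ ≤ C ∧
            ‖chartSymmDeriv c x ((extChartAt (𝓡 c) x).symm w)‖ ≤ C := by
      intro q hq w hw
      exact (hgeom w (Metric.closedBall_subset_closedBall (hθR' ε)
        (H.closedCube_subset_closedBall hq hw))).2
    have hP1 := hA1.isBlendingPair (hcube _ hq1) (hbd _ hD1)
    have hP2 := hA2.isBlendingPair (hcube _ hq2) (hbd _ hD2)
    refine ⟨hD1, hD2, H.disjoint_chartCube,
      ⟨hP1, fun i => ?_, hA1.closure_subset_iUnion_image, hS₁⟩,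
      ⟨hP2, fun i => ?_, hA2.closure_subset_iUnion_symm_image, hS₂⟩, H.hasTransition⟩
    · exact (φ i ε).toHomeomorph.isOpenMap _ hP1.1
    · exact (φ i ε).symm.toHomeomorph.isOpenMap _ hP2.1
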